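/- Let $k$ be a field of characteristic zero, let $n\ge 3$, and let $R=k[x_0,\dots,x_n]$. Let $\mathcal A$ be a hyperplane arrangement in $\mathbb P^n$, that is, a finite set of distinct hyperplanes, defined by pairwise non-proportional nonzero linear forms with product $F$, and let $J=\langle \partial F/\partial x_0,\dots,\partial F/\partial x_n\rangle$ be the Jacobian ideal of $F$. Let $\mathfrak q_1,\dots,\mathfrak q_r$ be the height two primary ideals in an irredundant primary decomposition of $J$, let $\mathfrak p_i=\sqrt{\mathfrak q_i}$, and put $\overline J=\mathfrak q_1\cap\dots\cap\mathfrak q_r$. For each $i$ let $a_i$ be the number of hyperplanes of $\mathcal A$ whose linear form lies in $\mathfrak p_i$. Let $b_1,\dots,b_r$ be any integers such that $b_i=1$ if $a_i=2$, and $0\le b_i\le a_i$ if $a_i\ge 3$ (with $\mathfrak p_i^0=R$). An empty intersection of ideals is $R$, and the zero ring counts as Cohen-Macaulay. Let $\overline V$ and $V^{red}$ be the subschemes of $\mathbb P^n$ defined by $\overline J$ and $\sqrt J$; the components of $\overline V$ are the subschemes defined by the $\mathfrak q_i$, and the $i$-th one is non-reduced if $\mathfrak q_i\ne\mathfrak p_i$.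 Assume that no hyperplane of $\mathcal A$ contains the support of more than one non-reduced component of $\overline V$; that is, no linear form of the arrangement lies in $\mathfrak p_i$ for two different $i$ with $\mathfrak q_i\neq\mathfrak p_i$. Then $\overline V$, $V^{red}$ and the scheme defined by $\bigcap_i \mathfrak p_i^{b_i}$ are all arithmetically Cohen-Macaulay. More precisely, the ideals $\overline J$, $\sqrt J$ and $\bigcap_i\mathfrak p_i^{b_i}$ are saturated with respect to $(x_0,\dots,x_n)$, and the rings $R/\overline J$, $R/\sqrt J$ and $R/\bigcap_i\mathfrak p_i^{b_i}$ are Cohen-Macaulay. -/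

import Mathlib

open MvPolynomial

/-- A local ring is Cohen-Macaulay when its maximal ideal contains a regular sequence whose length
is the Krull dimension of the ring (i.e. depth equals dimension). Used for Noetherian local rings
only. -/
def IsCohenMacaulayLocal (A : Type*) [CommRing A] [IsLocalRing A] : Prop :=
  ∃ rs : List A, (∀ r ∈ rs, r ∈ IsLocalRing.maximalIdeal A) ∧
    RingTheory.Sequence.IsRegular A rs ∧ (rs.length : WithBot ℕ∞) = ringKrullDim A

/-- A ring is Cohen-Macaulay when it is Noetherian and its localizations at all maximal ideals
are Cohen-Macaulay local rings. (The zero ring is Cohen-Macaulay.) -/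
def IsCohenMacaulayRing (A : Type*) [CommRing A] : Prop :=
  IsNoetherianRing A ∧
    ∀ (m : Ideal A) [m.IsMaximal], IsCohenMacaulayLocal (Localization.AtPrime m)

section Projective

variable {k : Type*} [Field k] {n : ℕ}

/-- The ideal `(x₀, …, xₙ)` of `k[x₀, …, xₙ]`. -/
noncomputable def irrelevantIdeal (k : Type*) [Field k] (n : ℕ) : Ideal (MvPolynomial (Fin (n + 1)) k) :=
  Ideal.span (Set.range X)

/-- The saturation `⋃ N, (I : (x₀, …, xₙ) ^ N)`; for homogeneous `I` this is the saturated
ideal of the closed subscheme of projective `n`-space defined by `I`. -/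
noncomputable def saturation (I : Ideal (MvPolynomial (Fin (n + 1)) k)) :
    Ideal (MvPolynomial (Fin (n + 1)) k) :=
  ⨆ N : ℕ, Submodule.colon I ((irrelevantIdeal k n ^ N : Ideal _) : Set _)

/-- The closed subscheme of projective `n`-space defined by the homogeneous ideal `I` is
arithmetically Cohen-Macaulay: its homogeneous coordinate ring is Cohen-Macaulay. -/
def IsACM (I : Ideal (MvPolynomial (Fin (n + 1)) k)) : Prop :=
  IsCohenMacaulayRing (MvPolynomial (Fin (n + 1)) k ⧸ saturation I)

/-- The members of a primary decomposition `t` that have height two. -/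
def heightTwoComponents (t : Finset (Ideal (MvPolynomial (Fin (n + 1)) k))) :
    Set (Ideal (MvPolynomial (Fin (n + 1)) k)) :=
  {q | q ∈ t ∧ q.height = 2}

/-- The intersection of the height two primary ideals in a primary decomposition `t`. -/
noncomputable def topDimensionalPart (t : Finset (Ideal (MvPolynomial (Fin (n + 1)) k))) :
    Ideal (MvPolynomial (Fin (n + 1)) k) :=
  ⨅ q ∈ heightTwoComponents t, q

/-- The intersection of the powers `𝔭 ^ b 𝔭`, where `𝔭` runs through the height two associated
primes, i.e. the radicals of the height two members of the primary decomposition `t`. -/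
noncomputable def fatIdeal (t : Finset (Ideal (MvPolynomial (Fin (n + 1)) k)))
    (b : Ideal (MvPolynomial (Fin (n + 1)) k) → ℕ) :
    Ideal (MvPolynomial (Fin (n + 1)) k) :=
  ⨅ q ∈ heightTwoComponents t, q.radical ^ b q.radical

end Projective

/-- A hyperplane arrangement in projective `n`-space over `k`: a finite set of distinct
hyperplanes, each given by one linear form. -/
structure HyperplaneArrangement (k : Type*) [Field k] (n : ℕ) where
  /-- The linear forms defining the hyperplanes. -/
  forms : Finset (MvPolynomial (Fin (n + 1)) k)
  isHomogeneous : ∀ L ∈ forms, L.IsHomogeneous 1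
  ne_zero : ∀ L ∈ forms, L ≠ 0
  pairwise_independent :
    (forms : Set (MvPolynomial (Fin (n + 1)) k)).Pairwise fun L L' => LinearIndependent k ![L, L']

namespace HyperplaneArrangement

variable {k : Type*} [Field k] {n : ℕ} (A : HyperplaneArrangement k n)

/-- The product of the linear forms of the arrangement. -/
noncomputable def poly : MvPolynomial (Fin (n + 1)) k := ∏ L ∈ A.forms, L

/-- The ideal generated by the partial derivatives of the product of the linear forms. -/
noncomputable def jacobianIdeal : Ideal (MvPolynomial (Fin (n + 1)) k) :=
  Ideal.span (Set.range fun i => pderiv i A.poly)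

/-- The number of hyperplanes of the arrangement whose linear form lies in `p`. -/
noncomputable def multiplicity (p : Ideal (MvPolynomial (Fin (n + 1)) k)) : ℕ :=
  {L | L ∈ A.forms ∧ L ∈ p}.ncard

end HyperplaneArrangement

/-!
# Schemes supported on the singular locus of a hyperplane arrangement

Let `R = k[x₀, …, xₙ]`. Call a height two prime generated by two forms of the arrangement a flat.
Choose `n - 1` linear forms `y` so general that, for every flat `(L, M)`, the forms `y`, `L`, `M`
are a basis of the space of linear forms, and put `S = k[y]`
(`MvPolynomial.exists_hasFlatCharts`). If `R ⧸ I` is a finite projective `S`-module, then `R ⧸ I`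
is Cohen-Macaulay (`isCohenMacaulayRing_of_finite_of_flat`), and `I` is saturated because each
variable of `S` is a nonzerodivisor modulo `I` (`saturation_eq_and_isACM`). So it is enough to
find that all ideals in question have finite projective quotients, a property which is inherited
by the middle term of an exact sequence.

Write `R = S[L, M]` for a flat `p = (L, M)`, and let `G` be the product of the forms in `p`.
Localizing at `p`, where the other forms are units, one sees that the component of the Jacobian
ideal with radical `p` is the Jacobian ideal of `G` (`HyperplaneArrangement.eq_localJacobian`); it
equals `p` if `p` contains two forms and lies in `p ^ 2` if it contains more. Like the powers of
`p`, it is extended from an ideal `I₀` of `k[L, M]` and contains a power of `p`, so its quotient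
is the finite free `S`-module `S ⊗ (k[L, M] ⧸ I₀)`.

By hypothesis the flats with at least three forms involve pairwise disjoint sets of forms. Group
the forms accordingly, a form in no such flat being a group of its own. Two forms in different
groups span a flat with only two forms, so for disjoint unions `T`, `T'` of groups the
corresponding flats intersect in the complete intersection `(∏ T, ∏ T')`. Adding one group at a
time, the intersection of the ideals attached to the flats is then of the form `I₁ ∩ I₂ ∩ (f, g)`
with `f = ∏ T ∈ I₁` and `g = ∏ T' ∈ I₂`, and liaison addition
(`IsFiniteProjectiveQuotient.inf_inf_span_pair`) shows that its quotient is finite projective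
(`FlatSystem.finite_inter`). This applies to the components of `J`, to the flats themselves, which
are the minimal primes of `J`, and to the powers `p ^ b` with `b` at most the number of forms in
`p`.
-/

open MvPolynomial

/-! ### Rings finite and flat over a polynomial ring -/

/-- A monic polynomial stays a nonzerodivisor after the coefficient ring is divided by an ideal. -/
theorem isSMulRegular_quotient_map_C_of_monic {T : Type*} [CommRing T] (rs : List T)
    {f : Polynomial T} (hf : f.Monic) :
    IsSMulRegular (Polynomial T ⧸ (Ideal.ofList (rs.map (algebraMap T (Polynomial T))) •
      ⊤ : Submodule (Polynomial T) (Polynomial T))) f := by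
  have key : ∀ g : Polynomial T, g ∈ (Ideal.ofList (rs.map (algebraMap T (Polynomial T))) •
      ⊤ : Submodule (Polynomial T) (Polynomial T)) ↔
      g.map (Ideal.Quotient.mk (Ideal.ofList rs)) = 0 := by
    intro g
    rw [← Ideal.map_ofList, smul_eq_mul, Ideal.mul_top, Polynomial.algebraMap_eq,
      ← Polynomial.coe_mapRingHom, ← RingHom.mem_ker, Polynomial.ker_mapRingHom, Ideal.mk_ker]
  rw [isSMulRegular_iff_right_eq_zero_of_smul]
  intro x hx
  obtain ⟨g, rfl⟩ := Submodule.Quotient.mk_surjective _ x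
  rw [← Submodule.Quotient.mk_smul, Submodule.Quotient.mk_eq_zero, key, smul_eq_mul,
    Polynomial.map_mul] at hx
  rw [Submodule.Quotient.mk_eq_zero, key]
  exact (hf.map _).mul_right_eq_zero_iff.mp hx

open RingTheory.Sequence in
/-- Every maximal ideal of a polynomial ring in `d` variables over a field contains a weakly regular
sequence of length `d`. In the inductive step the new member is a monic polynomial in the new
variable; it exists because the residue field is integral over the smaller polynomial ring, which
is a Jacobson ring. -/
theorem exists_isWeaklyRegular_of_isMaximal (k : Type*) [Field k] (d : ℕ)
    (m : Ideal (MvPolynomial (Fin d) k)) [m.IsMaximal] :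
    ∃ rs : List (MvPolynomial (Fin d) k), (∀ r ∈ rs, r ∈ m) ∧
      IsWeaklyRegular (MvPolynomial (Fin d) k) rs ∧ rs.length = d := by
  induction d with
  | zero => exact ⟨[], by simp, by simp, rfl⟩
  | succ d ih =>
    set T := MvPolynomial (Fin d) k
    let e := finSuccEquiv k d
    let m' : Ideal (Polynomial T) := m.comap (e.symm : Polynomial T →+* _)
    have hm' : m'.IsMaximal := Ideal.comap_isMaximal_of_equiv e.symm
    have hmC := Polynomial.isMaximal_comap_C_of_isJacobsonRing m'
    obtain ⟨rs, hrs, hreg, hlen⟩ := ih (m'.comap Polynomial.C)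
    obtain ⟨f, hf, hf0⟩ := Polynomial.quotient_mk_comp_C_isIntegral_of_isJacobsonRing m'
      (Ideal.Quotient.mk m' Polynomial.X)
    have hfm : f ∈ m' := by
      rw [← Polynomial.hom_eval₂, Polynomial.eval₂_C_X] at hf0
      exact Ideal.Quotient.eq_zero_iff_mem.mp hf0
    have hreg' : IsWeaklyRegular (Polynomial T) (rs.map (algebraMap T (Polynomial T)) ++ [f]) := by
      rw [isWeaklyRegular_append_iff]
      refine ⟨hreg.of_flat, ?_⟩
      rw [isWeaklyRegular_singleton_iff]
      exact isSMulRegular_quotient_map_C_of_monic _ hf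
    refine ⟨(rs.map (algebraMap T (Polynomial T)) ++ [f]).map e.symm, ?_, ?_, by simp [hlen]⟩
    · intro r hr
      simp only [List.map_append, List.map_map, List.mem_append, List.mem_map, Function.comp,
        List.map_cons, List.map_nil, List.mem_singleton] at hr
      rcases hr with ⟨a, ha, rfl⟩ | rfl
      · exact hrs a ha
      · exact hfm
    · have := AddEquiv.isWeaklyRegular_congr (e := e.symm.toRingEquiv.toAddEquiv)
        (as := (rs.map (algebraMap T (Polynomial T)) ++ [f]))
        (bs := (rs.map (algebraMap T (Polynomial T)) ++ [f]).map e.symm) ?_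
      · exact this.mp hreg'
      · rw [List.forall₂_map_right_iff]
        apply List.forall₂_same.mpr
        intro x hx y
        simp

theorem ringKrullDim_le_of_isIntegral (S B : Type*) [CommRing S] [CommRing B] [Algebra S B]
    [Algebra.IsIntegral S B] : ringKrullDim B ≤ ringKrullDim S :=
  Order.krullDim_le_of_strictMono (PrimeSpectrum.comap (algebraMap S B)) fun _ _ hpq ↦
    Ideal.IsIntegral.comap_lt_comap (R := S) hpq

open RingTheory.Sequence in
/-- A ring which is finite and flat over a polynomial ring over a field is Cohen-Macaulay: at every
maximal ideal, flatness bounds the depth from below by the number of variables, and integrality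
bounds the dimension from above by the same number. -/
theorem isCohenMacaulayRing_of_finite_of_flat (k : Type*) [Field k] (d : ℕ) (B : Type*)
    [CommRing B] [Algebra (MvPolynomial (Fin d) k) B] [Module.Finite (MvPolynomial (Fin d) k) B]
    [Module.Flat (MvPolynomial (Fin d) k) B] : IsCohenMacaulayRing B := by
  set S := MvPolynomial (Fin d) k
  have hN : IsNoetherianRing B :=
    isNoetherian_of_tower S (isNoetherian_of_isNoetherianRing_of_finite S B)
  refine ⟨hN, fun m hm ↦ ?_⟩
  have hmS : (m.comap (algebraMap S B)).IsMaximal :=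
    Ideal.isMaximal_comap_of_isIntegral_of_isMaximal (R := S) m
  obtain ⟨rs, hrs, hreg, hlen⟩ := exists_isWeaklyRegular_of_isMaximal k d (m.comap (algebraMap S B))
  have hflat : Module.Flat S (Localization.AtPrime m) :=
    Module.Flat.trans S B (Localization.AtPrime m)
  have hmem : ∀ r ∈ rs.map (algebraMap S (Localization.AtPrime m)),
      r ∈ IsLocalRing.maximalIdeal (Localization.AtPrime m) := by
    intro r hr
    obtain ⟨s, hs, rfl⟩ := List.mem_map.mp hr
    rw [IsScalarTower.algebraMap_apply S B (Localization.AtPrime m),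
      ← Localization.AtPrime.map_eq_maximalIdeal]
    exact Ideal.mem_map_of_mem _ (Ideal.mem_comap.mp (hrs s hs))
  have hR : IsRegular (Localization.AtPrime m)
      (rs.map (algebraMap S (Localization.AtPrime m))) :=
    IsRegular.of_isWeaklyRegular_of_mem_maximalIdeal _ hmem hreg.of_flat
  refine ⟨_, hmem, hR, le_antisymm ?_ ?_⟩
  · rw [← ringKrullDim_add_length_eq_ringKrullDim_of_isRegular _ hR]
    have : Nontrivial (Localization.AtPrime m ⧸
        Ideal.ofList (rs.map (algebraMap S (Localization.AtPrime m)))) :=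
      Ideal.Quotient.nontrivial_iff.mpr fun h ↦ hR.top_ne_smul (by simp [h])
    exact le_add_of_nonneg_left ringKrullDim_nonneg_of_nontrivial
  · rw [List.length_map, hlen, IsLocalization.AtPrime.ringKrullDim_eq_height m]
    refine (Ideal.height_le_ringKrullDim_of_ne_top hm.ne_top).trans
      ((ringKrullDim_le_of_isIntegral S B).trans ?_)
    simp [S, MvPolynomial.ringKrullDim_of_isNoetherianRing]

/-! ### Finite projective quotients and liaison addition -/

/-- The `S`-algebra `R ⧸ I` is finite and projective as an `S`-module. -/
def IsFiniteProjectiveQuotient (S : Type*) {R : Type*} [CommRing S] [CommRing R] [Algebra S R]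
    (I : Ideal R) : Prop :=
  Module.Finite S (R ⧸ I) ∧ Module.Projective S (R ⧸ I)

namespace IsFiniteProjectiveQuotient

variable {S R : Type*} [CommRing S] [CommRing R] [Algebra S R]

theorem top : IsFiniteProjectiveQuotient S (⊤ : Ideal R) :=
  have : Subsingleton (R ⧸ (⊤ : Ideal R)) := Ideal.Quotient.subsingleton_iff.mpr rfl
  ⟨inferInstance, inferInstance⟩

/-- Nonzero elements of `S` are nonzerodivisors on `R ⧸ I`. -/
theorem mem_of_algebraMap_mul_mem [IsDomain S] {I : Ideal R} (hI : IsFiniteProjectiveQuotient S I)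
    {s : S} (hs : s ≠ 0) {u : R} (hu : algebraMap S R s * u ∈ I) : u ∈ I := by
  obtain ⟨_, _⟩ := hI
  have h : s • Ideal.Quotient.mk I u = 0 := by
    rw [Algebra.smul_def, ← Ideal.Quotient.mk_algebraMap, ← map_mul]
    exact Ideal.Quotient.eq_zero_iff_mem.mpr hu
  exact Ideal.Quotient.eq_zero_iff_mem.mp ((smul_eq_zero.mp h).resolve_left hs)

theorem _root_.Module.Projective.of_exact {M N P : Type*} [AddCommGroup M] [AddCommGroup N]
    [AddCommGroup P] [Module S M] [Module S N] [Module S P] {f : M →ₗ[S] N} {g : N →ₗ[S] P}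
    (hf : Function.Injective f) (hfg : Function.Exact f g) (hg : Function.Surjective g)
    [Module.Projective S M] [Module.Projective S P] : Module.Projective S N := by
  obtain ⟨l, hl⟩ := Module.projective_lifting_property g LinearMap.id hg
  obtain ⟨e, -, -⟩ := hfg.splitSurjectiveEquiv hf ⟨l, hl⟩
  exact Module.Projective.of_equiv e.symm

/-- If `I = K : g` and `J = K + (g)`, then multiplication by `g` gives an exact sequence
`0 → R ⧸ I → R ⧸ K → R ⧸ J → 0`. -/
theorem of_exact {I J K : Ideal R} (g : R) (hI : IsFiniteProjectiveQuotient S I)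
    (hJ : IsFiniteProjectiveQuotient S J)
    (h₁ : ∀ u, u * g ∈ K ↔ u ∈ I) (hJK : J = K ⊔ Ideal.span {g}) :
    IsFiniteProjectiveQuotient S K := by
  obtain ⟨_, _⟩ := hI
  obtain ⟨_, _⟩ := hJ
  obtain ⟨φ, hφ₀⟩ : ∃ φ : (R ⧸ I) →ₗ[R] (R ⧸ K), ∀ u : R,
      φ (Submodule.Quotient.mk u) = Submodule.Quotient.mk (u * g) :=
    ⟨Submodule.liftQ I (Submodule.mkQ K ∘ₗ LinearMap.mulRight R g) fun u hu ↦
      (Submodule.Quotient.mk_eq_zero K).mpr ((h₁ u).mpr hu), fun u ↦ rfl⟩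
  obtain ⟨ψ, hψ₀⟩ : ∃ ψ : (R ⧸ K) →ₗ[R] (R ⧸ J), ∀ u : R,
      ψ (Submodule.Quotient.mk u) = Submodule.Quotient.mk u :=
    ⟨Submodule.factor (hJK ▸ le_sup_left), fun u ↦ rfl⟩
  have hφ : Function.Injective (φ.restrictScalars S) := by
    rw [LinearMap.coe_restrictScalars, injective_iff_map_eq_zero]
    intro x hx
    obtain ⟨u, rfl⟩ := Submodule.Quotient.mk_surjective _ x
    rw [hφ₀] at hx
    exact (Submodule.Quotient.mk_eq_zero _).mpr
      ((h₁ u).mp ((Submodule.Quotient.mk_eq_zero K).mp hx))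
  have hψ : Function.Surjective (ψ.restrictScalars S) := fun x ↦ by
    obtain ⟨u, rfl⟩ := Submodule.Quotient.mk_surjective _ x
    exact ⟨Submodule.Quotient.mk u, hψ₀ u⟩
  have hφψ : Function.Exact (φ.restrictScalars S) (ψ.restrictScalars S) := by
    intro x
    obtain ⟨u, rfl⟩ := Submodule.Quotient.mk_surjective _ x
    have : ψ (Submodule.Quotient.mk u) = 0 ↔ u ∈ J := by
      rw [hψ₀]; exact Submodule.Quotient.mk_eq_zero _
    rw [LinearMap.coe_restrictScalars, LinearMap.coe_restrictScalars, this, hJK, Submodule.mem_sup]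
    constructor
    · rintro ⟨y, hy, z, hz, rfl⟩
      obtain ⟨a, rfl⟩ := Ideal.mem_span_singleton'.mp hz
      refine ⟨Submodule.Quotient.mk a, (hφ₀ a).trans ((Submodule.Quotient.eq K).mpr ?_)⟩
      simpa using K.neg_mem hy
    · rintro ⟨y, hy⟩
      obtain ⟨a, rfl⟩ := Submodule.Quotient.mk_surjective _ y
      refine ⟨u - a * g, ?_, a * g, Ideal.mem_span_singleton'.mpr ⟨a, rfl⟩, by ring⟩
      rw [← neg_mem_iff, neg_sub]
      exact (Submodule.Quotient.eq K).mp ((hφ₀ a).symm.trans hy)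
  exact ⟨Module.Finite.of_exact hφψ hψ, Module.Projective.of_exact hφ hφψ hψ⟩

/-- Liaison addition: for `f ∈ I₁` and `g ∈ I₂` the quotient of `R` by `I₁ ∩ I₂ ∩ (f, g)` is built
from `R ⧸ I₁`, `R ⧸ I₂` and `R ⧸ (f, g)` by two extensions. -/
theorem inf_inf_span_pair {I₁ I₂ : Ideal R} {f g : R} (h₁ : IsFiniteProjectiveQuotient S I₁)
    (h₂ : IsFiniteProjectiveQuotient S I₂)
    (hfg : IsFiniteProjectiveQuotient S (Ideal.span {f, g})) (hf : f ∈ I₁) (hg : g ∈ I₂)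
    (hg₁ : ∀ u, u * g ∈ I₁ → u ∈ I₁) (hf₂ : ∀ u, u * f ∈ I₂ → u ∈ I₂) :
    IsFiniteProjectiveQuotient S (I₁ ⊓ I₂ ⊓ Ideal.span {f, g}) := by
  set J := Ideal.span {f, g}
  have hfJ : f ∈ J := Ideal.subset_span (by simp)
  have hgJ : g ∈ J := Ideal.subset_span (by simp)
  have key : IsFiniteProjectiveQuotient S (I₁ ⊓ I₂ ⊓ J ⊔ Ideal.span {g}) := by
    refine of_exact f h₂ hfg (fun u ↦ ⟨fun h ↦ hf₂ u ?_, fun h ↦ ?_⟩) (le_antisymm ?_ ?_)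
    · have : I₁ ⊓ I₂ ⊓ J ⊔ Ideal.span {g} ≤ I₂ :=
        sup_le (inf_le_left.trans inf_le_right) ((Ideal.span_singleton_le_iff_mem _).mpr hg)
      exact this h
    · exact Ideal.mem_sup_left
        ⟨⟨I₁.mul_mem_left u hf, I₂.mul_mem_right f h⟩, J.mul_mem_left u hfJ⟩
    · rw [Ideal.span_le, Set.pair_subset_iff]
      exact ⟨Ideal.mem_sup_right (Ideal.mem_span_singleton_self f),
        Ideal.mem_sup_left (Ideal.mem_sup_right (Ideal.mem_span_singleton_self g))⟩
    · exact sup_le (sup_le inf_le_right ((Ideal.span_singleton_le_iff_mem _).mpr hgJ))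
        ((Ideal.span_singleton_le_iff_mem _).mpr hfJ)
  refine of_exact g h₁ key (fun u ↦ ⟨fun h ↦ hg₁ u h.1.1, fun h ↦ ?_⟩) rfl
  exact ⟨⟨I₁.mul_mem_right g h, I₂.mul_mem_left u hg⟩, J.mul_mem_left u hgJ⟩

theorem span_mul_pair {f g h : R} (hf : IsFiniteProjectiveQuotient S (Ideal.span {f, h}))
    (hg : IsFiniteProjectiveQuotient S (Ideal.span {g, h}))
    (hgh : ∀ u, h ∣ u * g → h ∣ u) :
    IsFiniteProjectiveQuotient S (Ideal.span {f * g, h}) := by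
  refine of_exact g hf hg (fun u ↦ ?_) ?_
  · simp only [Ideal.mem_span_pair]
    constructor
    · rintro ⟨a, b, hab⟩
      obtain ⟨c, hc⟩ := hgh (u - a * f) ⟨b, by linear_combination -hab⟩
      exact ⟨a, c, by linear_combination -hc⟩
    · rintro ⟨a, b, rfl⟩
      exact ⟨a, b * g, by ring⟩
  · rw [← Ideal.span_union]
    refine le_antisymm (Ideal.span_mono (by grind)) (Ideal.span_le.mpr ?_)
    rintro x ((rfl | rfl) | rfl)
    · exact Ideal.mul_mem_left _ _ (Ideal.subset_span (by simp))
    · exact Ideal.subset_span (by simp)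
    · exact Ideal.subset_span (by simp)

end IsFiniteProjectiveQuotient

/-- `(f g, h) = (f, h) ∩ (g, h)` if `f` is a nonzerodivisor modulo `(g, h)`. -/
theorem Ideal.span_mul_pair_eq_inf {R : Type*} [CommRing R] {f g h : R}
    (hf : ∀ u, u * f ∈ Ideal.span {g, h} → u ∈ Ideal.span {g, h}) :
    Ideal.span {f * g, h} = Ideal.span {f, h} ⊓ Ideal.span {g, h} := by
  refine le_antisymm ?_ ?_
  · rw [Ideal.span_le]
    rintro x (rfl | rfl)
    · exact ⟨Ideal.mul_mem_right _ _ (Ideal.subset_span (by simp)),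
        Ideal.mul_mem_left _ _ (Ideal.subset_span (by simp))⟩
    · exact ⟨Ideal.subset_span (by simp), Ideal.subset_span (by simp)⟩
  · rintro x ⟨hx, hx'⟩
    obtain ⟨a, b, rfl⟩ := Ideal.mem_span_pair.mp hx
    have : a * f ∈ Ideal.span {g, h} := by
      simpa using Ideal.sub_mem _ hx' (Ideal.mul_mem_left _ b
        (Ideal.subset_span (by simp) : h ∈ Ideal.span {g, h}))
    obtain ⟨c, d, hcd⟩ := Ideal.mem_span_pair.mp (hf a this)
    exact Ideal.mem_span_pair.mpr ⟨c, d * f + b, by rw [← hcd]; ring⟩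

theorem Ideal.span_prod_pair_eq_iInf {R : Type*} [CommRing R] {T : Finset R} {h : R}
    (hT : ∀ f ∈ T, ∀ g ∈ T, f ≠ g →
      ∀ u, u * f ∈ Ideal.span {g, h} → u ∈ Ideal.span {g, h}) :
    Ideal.span {∏ f ∈ T, f, h} = ⨅ f ∈ T, Ideal.span {f, h} := by
  classical
  induction T using Finset.induction_on with
  | empty =>
    simpa using (Ideal.eq_top_iff_one _).mpr (Ideal.subset_span (by simp))
  | insert f T hfT ih =>
    have ih := ih fun a ha b hb ↦ hT a (by simp [ha]) b (by simp [hb])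
    rw [Finset.prod_insert hfT, Finset.iInf_insert, ← ih]
    refine Ideal.span_mul_pair_eq_inf fun u hu ↦ ?_
    simp only [ih, Ideal.mem_iInf] at hu ⊢
    exact fun g hg ↦ hT f (by simp) g (by simp [hg]) (by grind) u (hu g hg)

theorem IsFiniteProjectiveQuotient.span_prod_pair {S R : Type*} [CommRing S] [CommRing R]
    [Algebra S R] {T : Finset R} {h : R}
    (hT : ∀ f ∈ T, IsFiniteProjectiveQuotient S (Ideal.span {f, h}))
    (hh : ∀ f ∈ T, ∀ u, h ∣ u * f → h ∣ u) :
    IsFiniteProjectiveQuotient S (Ideal.span {∏ f ∈ T, f, h}) := by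
  classical
  induction T using Finset.induction_on with
  | empty =>
    rw [(Ideal.eq_top_iff_one _).mpr (Ideal.subset_span (by simp))]
    exact IsFiniteProjectiveQuotient.top
  | insert f T hfT ih =>
    rw [Finset.prod_insert hfT, mul_comm]
    exact span_mul_pair (ih (fun a ha ↦ hT a (by simp [ha])) fun a ha ↦ hh a (by simp [ha]))
      (hT f (by simp)) (hh f (by simp))

/-! ### Ideals attached to flats -/

open Classical in
/-- A finite set `forms` of pairwise relatively prime elements of `R`, any two of which span a
prime ideal `p`, called a flat, and an ideal `c p` attached to each flat `p`, such that the
following holds. A flat is spanned by any two of the members of `forms` in it. The quotients of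
`R` by `p` and by `c p` are finite projective `S`-modules. If `p` contains only two members of
`forms` then `c p = p`; in general `c p` contains the product of the members of `forms` in `p`,
and elements outside `p` are nonzerodivisors modulo `c p`. A member of `forms` lies in at most one
flat with three or more members.

The values of `c` at ideals which are not flats are irrelevant. -/
structure FlatSystem (S : Type*) {R : Type*} [CommRing S] [CommRing R] [Algebra S R]
    (forms : Finset R) (c : Ideal R → Ideal R) : Prop where
  isRelPrime : ∀ L ∈ forms, ∀ M ∈ forms, L ≠ M → IsRelPrime L M
  isPrime : ∀ L ∈ forms, ∀ M ∈ forms, L ≠ M → (Ideal.span {L, M}).IsPrime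
  finite : ∀ L ∈ forms, ∀ M ∈ forms, L ≠ M → IsFiniteProjectiveQuotient S (Ideal.span {L, M})
  span_eq : ∀ L ∈ forms, ∀ M ∈ forms, L ≠ M → ∀ L' ∈ forms, ∀ M' ∈ forms, L' ≠ M' →
    L' ∈ Ideal.span {L, M} → M' ∈ Ideal.span {L, M} → Ideal.span {L', M'} = Ideal.span {L, M}
  eq_self : ∀ L ∈ forms, ∀ M ∈ forms, L ≠ M →
    (forms.filter (· ∈ Ideal.span {L, M})).card < 3 → c (Ideal.span {L, M}) = Ideal.span {L, M}
  finite_c : ∀ L ∈ forms, ∀ M ∈ forms, L ≠ M →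
    IsFiniteProjectiveQuotient S (c (Ideal.span {L, M}))
  primary : ∀ L ∈ forms, ∀ M ∈ forms, L ≠ M → ∀ s ∉ Ideal.span {L, M}, ∀ u,
    u * s ∈ c (Ideal.span {L, M}) → u ∈ c (Ideal.span {L, M})
  prod_mem : ∀ L ∈ forms, ∀ M ∈ forms, L ≠ M →
    ∏ f ∈ forms.filter (· ∈ Ideal.span {L, M}), f ∈ c (Ideal.span {L, M})
  unique : ∀ L ∈ forms, ∀ M ∈ forms, L ≠ M → ∀ M' ∈ forms, L ≠ M' →
    3 ≤ (forms.filter (· ∈ Ideal.span {L, M})).card →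
    3 ≤ (forms.filter (· ∈ Ideal.span {L, M'})).card → Ideal.span {L, M} = Ideal.span {L, M'}

namespace FlatSystem

variable {S R : Type*} [CommRing S] [CommRing R] [Algebra S R] {forms : Finset R}
  {c : Ideal R → Ideal R}

/-- The intersection of the ideals attached to the flats spanned by two members of `T`. -/
def inter (c : Ideal R → Ideal R) (T : Finset R) : Ideal R :=
  ⨅ L ∈ T, ⨅ M ∈ T, ⨅ _ : L ≠ M, c (Ideal.span {L, M})

theorem mem_inter {T : Finset R} {u : R} :
    u ∈ inter c T ↔ ∀ L ∈ T, ∀ M ∈ T, L ≠ M → u ∈ c (Ideal.span {L, M}) := by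
  simp [inter]

open Classical in
/-- A subset `T` of `forms` is closed if it contains the members of every flat which has at least
three members, one of them in `T`. -/
def IsClosed (forms T : Finset R) : Prop :=
  ∀ L ∈ T, ∀ M ∈ forms, L ≠ M → 3 ≤ (forms.filter (· ∈ Ideal.span {L, M})).card → M ∈ T

theorem _root_.Ideal.left_mem_span_pair (L M : R) : L ∈ Ideal.span {L, M} :=
  Ideal.subset_span (by simp)

theorem _root_.Ideal.right_mem_span_pair (L M : R) : M ∈ Ideal.span {L, M} :=
  Ideal.subset_span (by simp)

theorem prod_mem_inter (h : FlatSystem S forms c) {T : Finset R} (hT : T ⊆ forms)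
    (hc : IsClosed forms T) : ∏ f ∈ T, f ∈ inter c T := by
  classical
  refine mem_inter.mpr fun L hL M hM hLM ↦ ?_
  by_cases h3 : 3 ≤ (forms.filter (· ∈ Ideal.span {L, M})).card
  · refine Ideal.mem_of_dvd _ (Finset.prod_dvd_prod_of_subset _ T _ fun N hN ↦ ?_)
      (h.prod_mem L (hT hL) M (hT hM) hLM)
    obtain ⟨hN, hNp⟩ := Finset.mem_filter.mp hN
    rcases eq_or_ne L N with rfl | hLN
    · exact hL
    · refine hc L hL N hN hLN ?_
      rwa [h.span_eq L (hT hL) M (hT hM) hLM L (hT hL) N hN hLN (Ideal.left_mem_span_pair L M) hNp]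
  · rw [h.eq_self L (hT hL) M (hT hM) hLM (by omega)]
    exact Ideal.mem_of_dvd _ (Finset.dvd_prod_of_mem _ hL) (Ideal.left_mem_span_pair L M)

open Classical in
theorem three_le_card_of_mem_span_pair {L M N : R} (hL : L ∈ forms) (hM : M ∈ forms)
    (hN : N ∈ forms) (hLM : L ≠ M) (hLN : L ≠ N) (hMN : M ≠ N) (hNp : N ∈ Ideal.span {L, M}) :
    3 ≤ (forms.filter (· ∈ Ideal.span {L, M})).card := by
  rw [← Finset.card_eq_three.mpr ⟨L, M, N, hLM, hLN, hMN, rfl⟩]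
  refine Finset.card_le_card fun x hx ↦ ?_
  simp only [Finset.mem_insert, Finset.mem_singleton] at hx
  rcases hx with rfl | rfl | rfl
  · exact Finset.mem_filter.mpr ⟨hL, Ideal.left_mem_span_pair _ _⟩
  · exact Finset.mem_filter.mpr ⟨hM, Ideal.right_mem_span_pair _ _⟩
  · exact Finset.mem_filter.mpr ⟨hN, hNp⟩

theorem mem_inter_of_mul_prod_mem (h : FlatSystem S forms c) {T g : Finset R} (hT : T ⊆ forms)
    (hg : g ⊆ forms) (hc : IsClosed forms T) (hd : Disjoint T g) (u : R)
    (hu : u * ∏ f ∈ g, f ∈ inter c T) : u ∈ inter c T := by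
  classical
  rw [mem_inter] at hu ⊢
  intro L hL M hM hLM
  refine h.primary L (hT hL) M (hT hM) hLM _ ?_ u (hu L hL M hM hLM)
  have := h.isPrime L (hT hL) M (hT hM) hLM
  rw [Ideal.IsPrime.prod_mem_iff]
  rintro ⟨N, hN, hNp⟩
  have hNT : N ∉ T := fun h' ↦ Finset.disjoint_left.mp hd h' hN
  have hLN : L ≠ N := fun h' ↦ hNT (h' ▸ hL)
  have hMN : M ≠ N := fun h' ↦ hNT (h' ▸ hM)
  refine hNT (hc L hL N (hg hN) hLN ?_)
  rw [h.span_eq L (hT hL) M (hT hM) hLM L (hT hL) N (hg hN) hLN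
    (Ideal.left_mem_span_pair L M) hNp]
  exact three_le_card_of_mem_span_pair (hT hL) (hT hM) (hg hN) hLM hLN hMN hNp

/-- For disjoint `T` and `g` with `T` closed, the complete intersection `(∏ T, ∏ g)` is reduced:
it is the intersection of the flats spanned by a member of `T` and a member of `g`, each of which
contains no further member of `forms`. -/
theorem span_prod_prod_eq_iInf (h : FlatSystem S forms c) {T g : Finset R} (hT : T ⊆ forms)
    (hg : g ⊆ forms) (hc : IsClosed forms T) (hd : Disjoint T g) :
    Ideal.span {∏ f ∈ T, f, ∏ f ∈ g, f} = ⨅ L ∈ T, ⨅ M ∈ g, Ideal.span {L, M} := by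
  classical
  have h3 : ∀ L ∈ T, ∀ M ∈ g, L ≠ M ∧ (forms.filter (· ∈ Ideal.span {L, M})).card < 3 := by
    intro L hL M hM
    have hLM : L ≠ M := fun h' ↦ Finset.disjoint_left.mp hd hL (h' ▸ hM)
    refine ⟨hLM, ?_⟩
    by_contra! h3
    exact Finset.disjoint_left.mp hd (hc L hL M (hg hM) hLM h3) hM
  have key : ∀ L ∈ T, Ideal.span {L, ∏ f ∈ g, f} = ⨅ M ∈ g, Ideal.span {L, M} := by
    intro L hL
    rw [Set.pair_comm, Ideal.span_prod_pair_eq_iInf]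
    · simp_rw [Set.pair_comm]
    · intro M hM M' hM' hMM' u hu
      rw [Set.pair_comm] at hu ⊢
      obtain ⟨hLM', h3'⟩ := h3 L hL M' hM'
      have := h.isPrime L (hT hL) M' (hg hM') hLM'
      exact (this.mem_or_mem hu).resolve_right fun hMp ↦ h3'.not_ge
        (three_le_card_of_mem_span_pair (hT hL) (hg hM') (hg hM) hLM' (h3 L hL M hM).1 hMM'.symm
          hMp)
  rw [Ideal.span_prod_pair_eq_iInf]
  · exact iInf_congr fun L ↦ iInf_congr (key L)
  · intro L hL L' hL' hLL' u hu
    rw [key L' hL'] at hu ⊢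
    simp only [Ideal.mem_iInf] at hu ⊢
    intro M hM
    obtain ⟨hLM', h3'⟩ := h3 L' hL' M hM
    have := h.isPrime L' (hT hL') M (hg hM) hLM'
    exact (this.mem_or_mem (hu M hM)).resolve_right fun hLp ↦ h3'.not_ge
      (three_le_card_of_mem_span_pair (hT hL') (hg hM) (hT hL) hLM' hLL'.symm
        (h3 L hL M hM).1.symm hLp)

theorem finite_span_prod_prod [DecompositionMonoid R] (h : FlatSystem S forms c) {T g : Finset R}
    (hT : T ⊆ forms) (hg : g ⊆ forms) (hd : Disjoint T g) :
    IsFiniteProjectiveQuotient S (Ideal.span {∏ f ∈ T, f, ∏ f ∈ g, f}) := by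
  have hne : ∀ L ∈ T, ∀ M ∈ g, L ≠ M := fun L hL M hM h' ↦
    Finset.disjoint_left.mp hd hL (h' ▸ hM)
  refine IsFiniteProjectiveQuotient.span_prod_pair (fun L hL ↦ ?_) fun L hL u hu ↦
    (IsRelPrime.prod_left fun M hM ↦
      (h.isRelPrime L (hT hL) M (hg hM) (hne L hL M hM)).symm).dvd_of_dvd_mul_right hu
  rw [Set.pair_comm]
  refine IsFiniteProjectiveQuotient.span_prod_pair (fun M hM ↦ ?_) fun M hM u hu ↦
      (h.isRelPrime L (hT hL) M (hg hM) (hne L hL M hM)).dvd_of_dvd_mul_right hu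
  rw [Set.pair_comm]
  exact h.finite L (hT hL) M (hg hM) (hne L hL M hM)

/-- Together with `prod_mem_inter` this is the shape to which liaison addition applies. -/
theorem inter_union [DecidableEq R] (h : FlatSystem S forms c) {T g : Finset R} (hT : T ⊆ forms)
    (hg : g ⊆ forms) (hc : IsClosed forms T) (hd : Disjoint T g) :
    inter c (T ∪ g) = inter c T ⊓ inter c g ⊓ Ideal.span {∏ f ∈ T, f, ∏ f ∈ g, f} := by
  classical
  have hp : ∀ L ∈ T, ∀ M ∈ g, L ≠ M ∧ c (Ideal.span {L, M}) = Ideal.span {L, M} := by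
    intro L hL M hM
    have hLM : L ≠ M := fun h' ↦ Finset.disjoint_left.mp hd hL (h' ▸ hM)
    refine ⟨hLM, h.eq_self L (hT hL) M (hg hM) hLM ?_⟩
    by_contra! h3
    exact Finset.disjoint_left.mp hd (hc L hL M (hg hM) hLM h3) hM
  rw [h.span_prod_prod_eq_iInf hT hg hc hd]
  ext u
  simp only [Ideal.mem_inf, mem_inter, Ideal.mem_iInf, Finset.mem_union]
  constructor
  · intro hu
    refine ⟨⟨fun L hL M hM ↦ hu L (.inl hL) M (.inl hM), fun L hL M hM ↦
      hu L (.inr hL) M (.inr hM)⟩, fun L hL M hM ↦ ?_⟩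
    rw [← (hp L hL M hM).2]
    exact hu L (.inl hL) M (.inr hM) (hp L hL M hM).1
  · rintro ⟨⟨h1, h2⟩, h3⟩ L (hL | hL) M (hM | hM) hLM
    · exact h1 L hL M hM hLM
    · rw [(hp L hL M hM).2]
      exact h3 L hL M hM
    · rw [Set.pair_comm, (hp M hM L hL).2]
      exact h3 M hM L hL
    · exact h2 L hL M hM hLM

/-- A nonempty closed set contains a nonempty closed set with a finite projective quotient: the
members of a single flat, or a single form which lies only in flats with two members. -/
theorem exists_isClosed (h : FlatSystem S forms c) {T : Finset R} (hT : T ⊆ forms)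
    (hc : IsClosed forms T) (hne : T.Nonempty) :
    ∃ g ⊆ T, g.Nonempty ∧ IsClosed forms g ∧ IsFiniteProjectiveQuotient S (inter c g) := by
  classical
  obtain ⟨L, hL⟩ := hne
  by_cases hbig : ∃ M ∈ forms, L ≠ M ∧ 3 ≤ (forms.filter (· ∈ Ideal.span {L, M})).card
  · obtain ⟨M, hM, hLM, h3⟩ := hbig
    set p := Ideal.span {L, M}
    have hLp : L ∈ p := Ideal.left_mem_span_pair L M
    have hMp : M ∈ p := Ideal.right_mem_span_pair L M
    have hsp : ∀ L' ∈ forms, L' ∈ p → ∀ M' ∈ forms, M' ∈ p → L' ≠ M' →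
        Ideal.span {L', M'} = p := fun L' hL' hL'p M' hM' hM'p hne ↦
      h.span_eq L (hT hL) M hM hLM L' hL' M' hM' hne hL'p hM'p
    refine ⟨forms.filter (· ∈ p), fun N hN ↦ ?_, ⟨L, Finset.mem_filter.mpr ⟨hT hL, hLp⟩⟩, ?_, ?_⟩
    · obtain ⟨hN, hNp⟩ := Finset.mem_filter.mp hN
      rcases eq_or_ne L N with rfl | hLN
      · exact hL
      · exact hc L hL N hN hLN (by rwa [hsp L (hT hL) hLp N hN hNp hLN])
    · intro N hN N' hN' hNN' h3'
      obtain ⟨hN, hNp⟩ := Finset.mem_filter.mp hN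
      obtain ⟨Q, hQ, hQp, hNQ⟩ : ∃ Q ∈ forms, Q ∈ p ∧ N ≠ Q := by
        rcases eq_or_ne N L with rfl | hNL
        · exact ⟨M, hM, hMp, hLM⟩
        · exact ⟨L, hT hL, hLp, hNL⟩
      have hNQp := hsp N hN hNp Q hQ hQp hNQ
      have := h.unique N hN Q hQ hNQ N' hN' hNN' (by rwa [hNQp]) h3'
      refine Finset.mem_filter.mpr ⟨hN', ?_⟩
      rw [← hNQp, this]
      exact Ideal.right_mem_span_pair _ _
    · have : inter c (forms.filter (· ∈ p)) = c p := by
        refine le_antisymm (fun u hu ↦ ?_) fun u hu ↦ mem_inter.mpr fun L' hL' M' hM' hne ↦ ?_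
        · exact mem_inter.mp hu L (Finset.mem_filter.mpr ⟨hT hL, hLp⟩) M
            (Finset.mem_filter.mpr ⟨hM, hMp⟩) hLM
        · obtain ⟨hL', hL'p⟩ := Finset.mem_filter.mp hL'
          obtain ⟨hM', hM'p⟩ := Finset.mem_filter.mp hM'
          rwa [hsp L' hL' hL'p M' hM' hM'p hne]
      rw [this]
      exact h.finite_c L (hT hL) M hM hLM
  · push Not at hbig
    refine ⟨{L}, by simpa, by simp, ?_, ?_⟩
    · intro L' hL' M hM hLM h3
      obtain rfl := Finset.mem_singleton.mp hL'
      exact absurd h3 (hbig M hM hLM).not_ge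
    · have : inter c {L} = ⊤ := by simp [inter]
      rw [this]
      exact IsFiniteProjectiveQuotient.top

theorem finite_inter_of_isClosed [DecompositionMonoid R] (h : FlatSystem S forms c) :
    ∀ T ⊆ forms, IsClosed forms T → IsFiniteProjectiveQuotient S (inter c T) := by
  classical
  intro T
  induction T using Finset.strongInduction with
  | H T ih =>
    intro hT hc
    rcases T.eq_empty_or_nonempty with rfl | hne
    · have : inter c (∅ : Finset R) = ⊤ := by simp [inter]
      rw [this]
      exact IsFiniteProjectiveQuotient.top
    obtain ⟨g, hgT, hgne, hgc, hg⟩ := h.exists_isClosed hT hc hne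
    have hTc : IsClosed forms (T \ g) := by
      intro L hL M hM hLM h3
      obtain ⟨hL, hLg⟩ := Finset.mem_sdiff.mp hL
      refine Finset.mem_sdiff.mpr ⟨hc L hL M hM hLM h3, fun hMg ↦ hLg ?_⟩
      exact hgc M hMg L (hT hL) hLM.symm (by rwa [Set.pair_comm])
    have hT' : T \ g ⊆ forms := Finset.sdiff_subset.trans hT
    have hg' : g ⊆ forms := hgT.trans hT
    have hd : Disjoint g (T \ g) := Finset.disjoint_sdiff
    rw [← Finset.union_sdiff_of_subset hgT, h.inter_union hg' hT' hgc hd]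
    exact hg.inf_inf_span_pair (ih _ (Finset.sdiff_ssubset hgT hgne) hT' hTc)
      (h.finite_span_prod_prod hg' hT' hd) (h.prod_mem_inter hg' hgc) (h.prod_mem_inter hT' hTc)
      (h.mem_inter_of_mul_prod_mem hg' hT' hgc hd)
      (h.mem_inter_of_mul_prod_mem hT' hg' hTc hd.symm)

theorem finite_inter [DecompositionMonoid R] (h : FlatSystem S forms c) :
    IsFiniteProjectiveQuotient S (inter c forms) :=
  h.finite_inter_of_isClosed forms subset_rfl fun _ _ _ hM _ _ ↦ hM

end FlatSystem

/-! ### Ideals primary to a coordinate subspace of codimension two -/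

namespace MvPolynomial

variable {S R : Type*} [CommRing S] [CommRing R] [Algebra S R]

/-- The retraction of `R = S[x, y]` onto `S` which sends `x` and `y` to zero. -/
noncomputable def retraction (e : MvPolynomial (Fin 2) S ≃ₐ[S] R) : R →ₐ[S] S :=
  (aeval (0 : Fin 2 → S)).comp e.symm.toAlgHom

theorem span_pair_eq_map (e : MvPolynomial (Fin 2) S ≃ₐ[S] R) :
    Ideal.span {e (X 0), e (X 1)} = (idealOfVars (Fin 2) S).map e := by
  rw [idealOfVars, Ideal.map_span]
  congr 1
  ext x
  simp [Fin.exists_fin_two, eq_comm]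

theorem span_pair_eq_ker (e : MvPolynomial (Fin 2) S ≃ₐ[S] R) :
    Ideal.span {e (X 0), e (X 1)} = RingHom.ker (retraction e) := by
  rw [span_pair_eq_map]
  ext u
  obtain ⟨v, rfl⟩ := e.surjective u
  have h₁ : e v ∈ (idealOfVars (Fin 2) S).map e ↔ v ∈ idealOfVars (Fin 2) S := by
    rw [Ideal.mem_map_of_equiv]
    exact ⟨fun ⟨w, hw, h⟩ ↦ e.injective h ▸ hw, fun h ↦ ⟨v, h, rfl⟩⟩
  have h₂ : retraction e (e v) = constantCoeff v := by
    simp [retraction]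
  rw [h₁, RingHom.mem_ker, h₂, ← pow_one (idealOfVars _ _), mem_pow_idealOfVars_iff']
  simp [constantCoeff_eq, Finsupp.degree_eq_zero_iff]

theorem isPrime_span_pair [IsDomain S] (e : MvPolynomial (Fin 2) S ≃ₐ[S] R) :
    (Ideal.span {e (X 0), e (X 1)}).IsPrime := by
  rw [span_pair_eq_ker]
  exact RingHom.ker_isPrime _

theorem height_span_pair [IsDomain S] [IsNoetherianRing R] (e : MvPolynomial (Fin 2) S ≃ₐ[S] R) :
    (Ideal.span {e (X 0), e (X 1)}).height = 2 := by
  have : IsDomain R := e.toRingEquiv.symm.toMulEquiv.isDomain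
  have hp := isPrime_span_pair e
  have hX : Prime (e (X 0)) := (MulEquiv.prime_iff e.toMulEquiv).mpr X_prime
  have hp₁ : (Ideal.span {e (X 0)}).IsPrime := (Ideal.span_singleton_prime hX.ne_zero).mpr hX
  refine le_antisymm ?_ ?_
  · refine (Ideal.height_le_spanFinrank _ hp.ne_top).trans ?_
    exact_mod_cast (Submodule.spanFinrank_span_le_ncard_of_finite (Set.toFinite _)).trans
      ((Set.ncard_insert_le _ _).trans (by simp))
  · have h₁ : (⊥ : Ideal R).height + 1 ≤ (Ideal.span {e (X 0)}).height :=
      Ideal.height_add_one_le_of_lt_of_isPrime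
        (bot_lt_iff_ne_bot.mpr (by simp))
    have h₂ : (Ideal.span {e (X 0)}).height + 1 ≤ (Ideal.span {e (X 0), e (X 1)}).height := by
      refine Ideal.height_add_one_le_of_lt_of_isPrime
        (lt_of_le_not_ge (Ideal.span_mono (by simp)) fun h ↦ ?_)
      have := Ideal.mem_span_singleton.mp (h (Ideal.right_mem_span_pair _ _))
      rw [map_dvd_iff, X_dvd_X] at this
      simp at this
    calc (2 : ℕ∞) = 0 + 1 + 1 := by norm_num
      _ ≤ (⊥ : Ideal R).height + 1 + 1 := by gcongr; exact zero_le
      _ ≤ _ := (add_le_add_left h₁ 1).trans h₂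

/-- If `I` contains a power of `p = (x, y)`, then elements outside `p` are nonzerodivisors modulo
`I`: such an element differs from its constant term `s₀ ≠ 0`, which is a nonzerodivisor because
`R ⧸ I` is torsion-free over `S`, by an element of `p`, which is nilpotent modulo `I`. -/
theorem mem_of_mul_mem_of_pow_le [IsDomain S] (e : MvPolynomial (Fin 2) S ≃ₐ[S] R) {I : Ideal R}
    (hI : IsFiniteProjectiveQuotient S I) {N : ℕ} (hN : Ideal.span {e (X 0), e (X 1)} ^ N ≤ I)
    {s u : R} (hs : s ∉ Ideal.span {e (X 0), e (X 1)}) (hu : u * s ∈ I) : u ∈ I := by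
  rw [span_pair_eq_ker, RingHom.mem_ker] at hs
  have hπ : algebraMap S R (retraction e s) - s ∈ Ideal.span {e (X 0), e (X 1)} := by
    rw [span_pair_eq_ker, RingHom.mem_ker, map_sub, AlgHom.commutes, Algebra.algebraMap_self_apply,
      sub_self]
  have h₀ : algebraMap S R (retraction e s) ^ N * u ∈ I := by
    have h₁ : (algebraMap S R (retraction e s) - s) ^ N ∈ I := hN (Ideal.pow_mem_pow hπ N)
    have h₂ := sub_dvd_pow_sub_pow (algebraMap S R (retraction e s))
      (algebraMap S R (retraction e s) - s) N
    rw [sub_sub_cancel] at h₂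
    have h₃ := Ideal.mem_of_dvd I (mul_dvd_mul_left u h₂) hu
    have h₄ := I.add_mem h₃ (I.mul_mem_left u h₁)
    ring_nf at h₄ ⊢
    exact h₄
  rw [← map_pow] at h₀
  exact hI.mem_of_algebraMap_mul_mem (pow_ne_zero N hs) h₀

/-- `R ⧸ I` is generated over `S` by the classes of `x` and `y`, which are nilpotent, hence
integral. -/
theorem finite_quotient_of_pow_le (e : MvPolynomial (Fin 2) S ≃ₐ[S] R) {I : Ideal R} {N : ℕ}
    (hN : Ideal.span {e (X 0), e (X 1)} ^ N ≤ I) : Module.Finite S (R ⧸ I) := by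
  let f : MvPolynomial (Fin 2) S →ₐ[S] R ⧸ I := (Ideal.Quotient.mkₐ S I).comp e.toAlgHom
  have hf : Function.Surjective f := (Ideal.Quotient.mkₐ_surjective S I).comp e.surjective
  have hfX : ∀ i, IsIntegral S (f (X i)) := by
    refine fun i ↦ IsIntegral.of_pow (n := N + 1) (by simp) ?_
    have h₁ : e (X i) ∈ Ideal.span {e (X 0), e (X 1)} :=
      Ideal.subset_span (by fin_cases i <;> simp)
    have h₂ : f (X i) ^ (N + 1) = 0 :=
      Ideal.Quotient.eq_zero_iff_mem.mpr
        (hN (Ideal.pow_le_pow_right N.le_succ (Ideal.pow_mem_pow h₁ (N + 1))))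
    rw [h₂]
    exact isIntegral_zero
  have hfg := fg_adjoin_of_finite (Set.finite_range fun i ↦ f (X i)) (Set.forall_mem_range.mpr hfX)
  have hrange : Algebra.adjoin S (Set.range fun i ↦ f (X i)) = ⊤ := by
    rw [Set.range_comp' f X, ← AlgHom.map_adjoin, adjoin_range_X, Algebra.map_top,
      AlgHom.range_eq_top]
    exact hf
  rw [hrange] at hfg
  exact ⟨hfg⟩

section

attribute [local instance] algebraMvPolynomial

/-- The quotient of `S[x, y]` by the extension of an ideal `I` of `k[x, y]` is
`S ⊗[k] (k[x, y] ⧸ I)`, a free `S`-module. -/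
theorem projective_quotient_map {k : Type*} [Field k] [Algebra k S]
    (e : MvPolynomial (Fin 2) S ≃ₐ[S] R) (I : Ideal (MvPolynomial (Fin 2) k)) :
    Module.Projective S (R ⧸ (I.map (map (algebraMap k S))).map e) := by
  have h : Module.Projective S (MvPolynomial (Fin 2) S ⧸
      I.map (algebraMap (MvPolynomial (Fin 2) k) (MvPolynomial (Fin 2) S))) :=
    Module.Projective.of_equiv
      (((Algebra.TensorProduct.quotIdealMapEquivTensorQuot (MvPolynomial (Fin 2) S)
        I).toLinearEquiv.restrictScalars S).trans
        (Algebra.IsPushout.cancelBaseChange k S (MvPolynomial (Fin 2) k)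
          (MvPolynomial (Fin 2) S) (MvPolynomial (Fin 2) k ⧸ I))).symm
  rw [algebraMap_def] at h
  exact Module.Projective.of_equiv (Ideal.quotientEquivAlg _ _ e rfl).toLinearEquiv

end

theorem isFiniteProjectiveQuotient_map {k : Type*} [Field k] [Algebra k S]
    (e : MvPolynomial (Fin 2) S ≃ₐ[S] R) (I : Ideal (MvPolynomial (Fin 2) k)) {N : ℕ}
    (hN : Ideal.span {e (X 0), e (X 1)} ^ N ≤ (I.map (map (algebraMap k S))).map e) :
    IsFiniteProjectiveQuotient S ((I.map (map (algebraMap k S))).map e) :=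
  ⟨finite_quotient_of_pow_le e hN, projective_quotient_map e I⟩

theorem isFiniteProjectiveQuotient_span_of_mem_adjoin {k : Type*} [Field k] [Algebra k S]
    [Algebra k R] [IsScalarTower k S R]
    (e : MvPolynomial (Fin 2) S ≃ₐ[S] R) {G : Set R}
    (hG : ∀ g ∈ G, g ∈ Algebra.adjoin k {e (X 0), e (X 1)}) {N : ℕ}
    (hN : Ideal.span {e (X 0), e (X 1)} ^ N ≤ Ideal.span G) :
    IsFiniteProjectiveQuotient S (Ideal.span G) := by
  let β : MvPolynomial (Fin 2) k →ₐ[k] R := aeval ![e (X 0), e (X 1)]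
  have hβ : ∀ q, β q = e (map (algebraMap k S) q) := by
    intro q
    induction q using MvPolynomial.induction_on with
    | C a =>
      rw [map_C, ← algebraMap_eq, ← algebraMap_eq, AlgHom.commutes, AlgEquiv.commutes]
      exact IsScalarTower.algebraMap_apply k S R a
    | add p q hp hq => simp [hp, hq]
    | mul_X p i hp =>
      rw [map_mul, hp, map_mul, map_mul, map_X]
      congr 1
      fin_cases i <;> simp [β]
  have hrange : Algebra.adjoin k {e (X 0), e (X 1)} = β.range := by
    rw [← Algebra.adjoin_range_eq_range_aeval]
    rw [Matrix.range_cons, Matrix.range_cons, Matrix.range_empty, Set.union_empty,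
      Set.singleton_union]
  have hspan : Ideal.span G = ((Ideal.span (β ⁻¹' G)).map (map (algebraMap k S))).map e := by
    rw [Ideal.map_span, Ideal.map_span, Set.image_image]
    simp_rw [← hβ]
    rw [Set.image_preimage_eq_of_subset]
    intro g hg
    have := hG g hg
    rwa [hrange] at this
  rw [hspan] at hN ⊢
  exact isFiniteProjectiveQuotient_map e _ hN

open scoped Pointwise in
theorem isFiniteProjectiveQuotient_span_pair_pow {k : Type*} [Field k] [Algebra k S]
    [Algebra k R] [IsScalarTower k S R] (e : MvPolynomial (Fin 2) S ≃ₐ[S] R) (N : ℕ) :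
    IsFiniteProjectiveQuotient S (Ideal.span {e (X 0), e (X 1)} ^ N) := by
  have h : Ideal.span {e (X 0), e (X 1)} ^ N = Ideal.span ({e (X 0), e (X 1)} ^ N) :=
    Submodule.span_pow _ _
  rw [h]
  refine isFiniteProjectiveQuotient_span_of_mem_adjoin (k := k) e (N := N) (fun g hg ↦ ?_) h.le
  have key : ∀ (m : ℕ), ∀ x ∈ ({e (X 0), e (X 1)} : Set R) ^ m,
      x ∈ Algebra.adjoin k {e (X 0), e (X 1)} := by
    intro m
    induction m with
    | zero => simp [one_mem]
    | succ m ih =>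
      rw [pow_succ]
      rintro _ ⟨x, hx, y, hy, rfl⟩
      exact mul_mem (ih x hx) (Algebra.subset_adjoin hy)
  exact key N g hg

end MvPolynomial

/-! ### Jacobian ideals of products of linear forms -/

namespace MvPolynomial

section radial

variable {S R : Type*} [CommRing S] [CommRing R] [Algebra S R]

/-- The derivation of `R` obtained from a derivation of `S[x, y]` by transport along an
isomorphism. -/
noncomputable def transportDerivation (e : MvPolynomial (Fin 2) S ≃ₐ[S] R)
    (D : Derivation S (MvPolynomial (Fin 2) S) (MvPolynomial (Fin 2) S)) : Derivation S R R :=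
  Derivation.mk' (e.toLinearMap ∘ₗ D.toLinearMap ∘ₗ e.symm.toLinearMap) fun a b ↦ by
    simp [Derivation.leibniz]

theorem transportDerivation_apply (e : MvPolynomial (Fin 2) S ≃ₐ[S] R)
    (D : Derivation S (MvPolynomial (Fin 2) S) (MvPolynomial (Fin 2) S))
    (q : MvPolynomial (Fin 2) S) : transportDerivation e D (e q) = e (D q) := by
  change e (D (e.symm (e q))) = _
  rw [e.symm_apply_apply]

/-- The derivation `x ∂/∂x + y ∂/∂y` of `R = S[x, y]`. It takes its values in `(x, y)` and
multiplies a product of `m` linear forms in `x` and `y` by `m`. -/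
noncomputable def radialDerivation (e : MvPolynomial (Fin 2) S ≃ₐ[S] R) : Derivation S R R :=
  transportDerivation e (mkDerivation S X)

theorem radialDerivation_apply (e : MvPolynomial (Fin 2) S ≃ₐ[S] R) (q : MvPolynomial (Fin 2) S) :
    radialDerivation e (e q) = e (mkDerivation S X q) :=
  transportDerivation_apply e _ q

theorem radialDerivation_mem (e : MvPolynomial (Fin 2) S ≃ₐ[S] R) (u : R) :
    radialDerivation e u ∈ Ideal.span {e (X 0), e (X 1)} := by
  obtain ⟨q, rfl⟩ := e.surjective u
  have hX : ∀ i, e (X i) ∈ Ideal.span {e (X 0), e (X 1)} := fun i ↦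
    Ideal.subset_span (by fin_cases i <;> simp)
  rw [radialDerivation_apply]
  induction q using MvPolynomial.induction_on with
  | C a => simp
  | add p q hp hq =>
    rw [map_add, map_add]
    exact add_mem hp hq
  | mul_X p i hp =>
    rw [Derivation.leibniz, mkDerivation_X, smul_eq_mul, smul_eq_mul, map_add, map_mul, map_mul]
    exact add_mem (Ideal.mul_mem_left _ _ (hX i)) (Ideal.mul_mem_left _ _ hp)

theorem radialDerivation_eq_self {k : Type*} [Field k] [Algebra k S] [Algebra k R]
    [IsScalarTower k S R] (e : MvPolynomial (Fin 2) S ≃ₐ[S] R) {u : R}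
    (hu : u ∈ Submodule.span k {e (X 0), e (X 1)}) : radialDerivation e u = u := by
  obtain ⟨a, b, rfl⟩ := Submodule.mem_span_pair.mp hu
  have h : ∀ (c : k) (v : R), radialDerivation e (c • v) = c • radialDerivation e v := fun c v ↦
    ((radialDerivation e).restrictScalars k).map_smul c v
  rw [map_add, h, h, radialDerivation_apply, radialDerivation_apply, mkDerivation_X,
    mkDerivation_X]

theorem _root_.Derivation.prod_eq_card_smul {A : Type*} [CommRing A] [Algebra S A]
    (D : Derivation S A A) (T : Finset A) (hT : ∀ N ∈ T, D N = N) :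
    D (∏ N ∈ T, N) = (T.card : A) * ∏ N ∈ T, N := by
  classical
  induction T using Finset.induction_on with
  | empty => simp
  | insert N T hN ih =>
    rw [Finset.prod_insert hN, Finset.card_insert_of_notMem hN, Derivation.leibniz,
      ih fun M hM ↦ hT M (by simp [hM]), hT N (by simp), smul_eq_mul, smul_eq_mul]
    push_cast
    ring

end radial

section jacobian

variable {k : Type*} [Field k] {ι : Type*}

/-- The ideal generated by the partial derivatives of `F`. -/
noncomputable def jacobian (F : MvPolynomial ι k) : Ideal (MvPolynomial ι k) :=
  Ideal.span (Set.range fun i ↦ pderiv i F)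

theorem pderiv_mem_jacobian (F : MvPolynomial ι k) (i : ι) : pderiv i F ∈ jacobian F :=
  Ideal.subset_span ⟨i, rfl⟩

/-- Every derivation is a linear combination of the partial derivatives. -/
theorem derivation_mem_jacobian [Fintype ι]
    (D : Derivation k (MvPolynomial ι k) (MvPolynomial ι k)) (F : MvPolynomial ι k) :
    D F ∈ jacobian F := by
  classical
  let D' : Derivation k (MvPolynomial ι k) (MvPolynomial ι k) := ∑ i, D (X i) • pderiv i
  have hD' : ∀ f, D' f = ∑ i, D (X i) * pderiv i f := fun f ↦ by
    have := congr_fun (map_sum (Derivation.coeFnAddMonoidHom (R := k) (A := MvPolynomial ι k)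
      (M := MvPolynomial ι k)) (fun i ↦ D (X i) • pderiv i) Finset.univ) f
    rw [Finset.sum_apply] at this
    exact this
  have h : D = D' := derivation_ext fun j ↦ by
    simp [hD', pderiv_X, Pi.single_apply]
  rw [h, hD']
  exact Ideal.sum_mem _ fun i _ ↦ Ideal.mul_mem_left _ _ (pderiv_mem_jacobian F i)

theorem prod_isHomogeneous {T : Finset (MvPolynomial ι k)}
    (hT : ∀ L ∈ T, L.IsHomogeneous 1) : (∏ L ∈ T, L).IsHomogeneous T.card := by
  simpa using IsHomogeneous.prod T (fun L ↦ L) (fun _ ↦ 1) hT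

/-- By Euler's identity, a product of linear forms lies in its own Jacobian ideal in characteristic
zero. -/
theorem prod_mem_jacobian [Fintype ι] [CharZero k] {T : Finset (MvPolynomial ι k)}
    (hT : ∀ L ∈ T, L.IsHomogeneous 1) (hne : T.Nonempty) :
    ∏ L ∈ T, L ∈ jacobian (∏ L ∈ T, L) := by
  set F := ∏ L ∈ T, L
  have h : (C (T.card : k) : MvPolynomial ι k) * F ∈ jacobian F := by
    have := (prod_isHomogeneous hT).sum_X_mul_pderiv
    rw [nsmul_eq_mul] at this
    rw [map_natCast, ← this]
    exact Ideal.sum_mem _ fun i _ ↦ Ideal.mul_mem_left _ _ (pderiv_mem_jacobian F i)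
  have hc : (T.card : k) ≠ 0 := by exact_mod_cast hne.card_pos.ne'
  refine (Ideal.unit_mul_mem_iff_mem _ ?_).mp h
  exact (IsUnit.mk0 _ hc).map C

theorem pderiv_eq_C {L : MvPolynomial ι k} (hL : L.IsHomogeneous 1) (i : ι) :
    pderiv i L = C (coeff 0 (pderiv i L)) :=
  totalDegree_eq_zero_iff_eq_C.mp ((totalDegree_zero_iff_isHomogeneous ι).mpr hL.pderiv)

theorem exists_pderiv_eq_C [Fintype ι] {L : MvPolynomial ι k} (hL : L.IsHomogeneous 1)
    (h0 : L ≠ 0) : ∃ i, ∃ c : k, c ≠ 0 ∧ pderiv i L = C c := by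
  have hC : ∀ i, ∃ c : k, pderiv i L = C c := fun i ↦
    ⟨_, pderiv_eq_C hL i⟩
  by_contra! h
  refine h0 ?_
  have := hL.sum_X_mul_pderiv
  rw [one_smul] at this
  rw [← this]
  refine Finset.sum_eq_zero fun i _ ↦ ?_
  obtain ⟨c, hc⟩ := hC i
  have : c = 0 := by
    by_contra h'
    exact h i c h' hc
  rw [hc, this, C_0, mul_zero]

/-- A product of linear forms is singular only where two of them vanish. -/
theorem exists_pair_mem_of_jacobian_le [Fintype ι] [CharZero k] {T : Finset (MvPolynomial ι k)}
    (hT : ∀ L ∈ T, L.IsHomogeneous 1) (h0 : ∀ L ∈ T, L ≠ 0) (hne : T.Nonempty)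
    {P : Ideal (MvPolynomial ι k)} [hP : P.IsPrime] (hJ : jacobian (∏ L ∈ T, L) ≤ P) :
    ∃ L ∈ T, ∃ M ∈ T, L ≠ M ∧ L ∈ P ∧ M ∈ P := by
  classical
  obtain ⟨L, hLT, hLP⟩ := (hP.prod_mem_iff).mp (hJ (prod_mem_jacobian hT hne))
  obtain ⟨i, c, hc, hi⟩ := exists_pderiv_eq_C (hT L hLT) (h0 L hLT)
  have h₁ := hJ (pderiv_mem_jacobian (∏ L ∈ T, L) i)
  rw [← Finset.mul_prod_erase T (fun L ↦ L) hLT, Derivation.leibniz, smul_eq_mul, smul_eq_mul,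
    hi] at h₁
  have h₂ := (P.add_mem_iff_right (P.mul_mem_right _ hLP)).mp h₁
  rw [mul_comm] at h₂
  have h₃ := (Ideal.unit_mul_mem_iff_mem _ ((IsUnit.mk0 _ hc).map C)).mp h₂
  obtain ⟨M, hMT, hMP⟩ := (hP.prod_mem_iff).mp h₃
  exact ⟨L, hLT, M, Finset.mem_of_mem_erase hMT, (Finset.ne_of_mem_erase hMT).symm, hLP, hMP⟩

theorem jacobian_prod_le_jacobian_prod [Fintype ι] [CharZero k] {T U : Finset (MvPolynomial ι k)}
    (hT : ∀ L ∈ T, L.IsHomogeneous 1) (hne : T.Nonempty) (hTU : T ⊆ U) :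
    jacobian (∏ L ∈ U, L) ≤ jacobian (∏ L ∈ T, L) := by
  classical
  refine Ideal.span_le.mpr ?_
  rintro _ ⟨i, rfl⟩
  rw [← Finset.prod_sdiff hTU]
  simp only [Derivation.leibniz, smul_eq_mul]
  exact add_mem (Ideal.mul_mem_left _ _ (pderiv_mem_jacobian _ i))
    (Ideal.mul_mem_right _ _ (prod_mem_jacobian hT hne))

/-- The derivations `∂/∂x` and `∂/∂y` send the product `x y` of the two coordinates to `y` and
`x`. -/
theorem jacobian_mul_eq [Fintype ι] {S : Type*} [CommRing S] [Algebra k S]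
    [Algebra S (MvPolynomial ι k)] [IsScalarTower k S (MvPolynomial ι k)]
    (e : MvPolynomial (Fin 2) S ≃ₐ[S] MvPolynomial ι k) :
    jacobian (e (X 0) * e (X 1)) = Ideal.span {e (X 0), e (X 1)} := by
  have h : ∀ i, e (pderiv i (X 0 * X 1)) ∈ jacobian (e (X 0) * e (X 1)) := fun i ↦ by
    rw [← map_mul, ← transportDerivation_apply]
    exact derivation_mem_jacobian ((transportDerivation e (pderiv i)).restrictScalars k) _
  refine le_antisymm (Ideal.span_le.mpr ?_) (Ideal.span_le.mpr ?_)
  · rintro _ ⟨i, rfl⟩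
    simp only [Derivation.leibniz, smul_eq_mul]
    exact add_mem (Ideal.mul_mem_right _ _ (Ideal.left_mem_span_pair _ _))
      (Ideal.mul_mem_right _ _ (Ideal.right_mem_span_pair _ _))
  · rw [Set.pair_subset_iff]
    exact ⟨by simpa [pderiv_X] using h 1, by simpa [pderiv_X] using h 0⟩

theorem pderiv_mem_adjoin {T : Set (MvPolynomial ι k)} (hT : ∀ L ∈ T, L.IsHomogeneous 1)
    {F : MvPolynomial ι k} (hF : F ∈ Algebra.adjoin k T) (i : ι) :
    pderiv i F ∈ Algebra.adjoin k T := by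
  induction hF using Algebra.adjoin_induction with
  | mem L hL =>
    rw [pderiv_eq_C (hT L hL)]
    exact (Algebra.adjoin k T).algebraMap_mem _
  | algebraMap r => simp [algebraMap_eq]
  | add x y _ _ hx hy => rw [map_add]; exact add_mem hx hy
  | mul x y hx' hy' hx hy =>
    rw [Derivation.leibniz]
    exact add_mem (mul_mem hx' hy) (mul_mem hy' hx)

theorem jacobian_prod_le_sq {T : Finset (MvPolynomial ι k)} {p : Ideal (MvPolynomial ι k)}
    (hT : ∀ L ∈ T, L ∈ p) (h3 : 3 ≤ T.card) : jacobian (∏ L ∈ T, L) ≤ p ^ 2 := by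
  classical
  obtain ⟨a, ha, b, hb, c, hc, hab, hac, hbc⟩ := Finset.two_lt_card.mp h3
  have h : ∏ L ∈ T, L = (a * b) * (c * ∏ L ∈ ((T.erase a).erase b).erase c, L) := by
    rw [Finset.mul_prod_erase _ (fun L ↦ L) (by grind), mul_assoc,
      Finset.mul_prod_erase _ (fun L ↦ L) (by grind), Finset.mul_prod_erase _ (fun L ↦ L) ha]
  refine Ideal.span_le.mpr ?_
  rintro _ ⟨i, rfl⟩
  have h₂ : ∀ x ∈ p, ∀ y ∈ p, x * y ∈ p ^ 2 := fun x hx y hy ↦ by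
    rw [pow_two]; exact Ideal.mul_mem_mul hx hy
  simp only [h, SetLike.mem_coe]
  rw [Derivation.leibniz (pderiv i) (a * b), Derivation.leibniz (pderiv i) a]
  simp only [smul_eq_mul]
  set r := ∏ L ∈ ((T.erase a).erase b).erase c, L
  have e₁ := h₂ a (hT a ha) b (hT b hb)
  have e₂ := h₂ c (hT c hc) a (hT a ha)
  have e₃ := h₂ c (hT c hc) b (hT b hb)
  have : a * b * (pderiv i) (c * r) + c * r * (a * (pderiv i) b + b * (pderiv i) a) =
      (pderiv i) (c * r) * (a * b) + (r * (pderiv i) b) * (c * a) +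
        (r * (pderiv i) a) * (c * b) := by
    ring
  rw [this]
  exact add_mem (add_mem (Ideal.mul_mem_left _ _ e₁) (Ideal.mul_mem_left _ _ e₂))
    (Ideal.mul_mem_left _ _ e₃)

/-- Let `G` be a product of linear forms in `x` and `y`, and `H` a product of forms outside
`p = (x, y)`. Then the Jacobian ideals of `G` and of `H G` agree after localization at `p`; this is
the inclusion which is not formal. With `D = x ∂/∂x + y ∂/∂y` and `m = deg G` one has
`D (H G) = (m H + D H) G`, and `m H + D H` is not in `p`, so `G` is in the localization of the
Jacobian ideal of `H G`; hence so is `H ∂G = ∂(H G) - G ∂H` for every partial derivative `∂`. -/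
theorem exists_notMem_mul_jacobian_le [Fintype ι] [CharZero k] {S : Type*} [CommRing S]
    [Algebra k S] [Algebra S (MvPolynomial ι k)] [IsScalarTower k S (MvPolynomial ι k)] [IsDomain S]
    (e : MvPolynomial (Fin 2) S ≃ₐ[S] MvPolynomial ι k) {T U : Finset (MvPolynomial ι k)}
    (hT : ∀ L ∈ T, L ∈ Submodule.span k {e (X 0), e (X 1)})
    (hU : ∀ L ∈ U, L ∉ Ideal.span {e (X 0), e (X 1)}) (hne : T.Nonempty) :
    ∃ s ∉ Ideal.span {e (X 0), e (X 1)}, ∀ u ∈ jacobian (∏ L ∈ T, L),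
      s * u ∈ jacobian ((∏ L ∈ U, L) * ∏ L ∈ T, L) := by
  have hp := isPrime_span_pair e
  set p := Ideal.span {e (X 0), e (X 1)}
  set G := ∏ L ∈ T, L
  set H := ∏ L ∈ U, L
  let D := (radialDerivation e).restrictScalars k
  have hDG : D G = (T.card : MvPolynomial ι k) * G :=
    D.prod_eq_card_smul T fun N hN ↦ radialDerivation_eq_self e (hT N hN)
  have hDH : D H ∈ p := radialDerivation_mem e H
  have hH : H ∉ p := fun h ↦ by
    obtain ⟨L, hL, hLp⟩ := (hp.prod_mem_iff).mp h
    exact hU L hL hLp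
  have hs : (T.card : MvPolynomial ι k) * H + D H ∉ p := by
    rw [p.add_mem_iff_left hDH]
    have hc : (T.card : k) ≠ 0 := by exact_mod_cast hne.card_pos.ne'
    have hu : IsUnit (T.card : MvPolynomial ι k) := by
      have := (IsUnit.mk0 _ hc).map (C (σ := ι))
      rwa [map_natCast] at this
    rwa [Ideal.unit_mul_mem_iff_mem _ hu]
  have hsG : ((T.card : MvPolynomial ι k) * H + D H) * G ∈ jacobian (H * G) := by
    have := derivation_mem_jacobian D (H * G)
    rw [Derivation.leibniz, hDG, smul_eq_mul, smul_eq_mul] at this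
    convert this using 1
    ring
  refine ⟨((T.card : MvPolynomial ι k) * H + D H) * H, hp.mul_notMem hs hH, fun u hu ↦ ?_⟩
  induction hu using Submodule.span_induction with
  | mem x hx =>
    obtain ⟨i, rfl⟩ := hx
    have h₁ := pderiv_mem_jacobian (H * G) i
    rw [Derivation.leibniz, smul_eq_mul, smul_eq_mul] at h₁
    have h₂ := sub_mem (Ideal.mul_mem_left _ ((T.card : MvPolynomial ι k) * H + D H) h₁)
      (Ideal.mul_mem_left _ (pderiv i H) hsG)
    convert h₂ using 1
    ring
  | zero => simp
  | add x y _ _ hx hy => rw [mul_add]; exact add_mem hx hy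
  | smul a x _ hx =>
    rw [smul_eq_mul, mul_left_comm]
    exact Ideal.mul_mem_left _ _ hx

end jacobian

end MvPolynomial

/-! ### Common complements and linear coordinates -/

/-- Over an infinite field, finitely many subspaces of dimension at most `r` have a common
complement, up to dimension. -/
theorem Submodule.exists_disjoint_of_finrank_add_le {k V κ : Type*} [Field k] [Infinite k]
    [AddCommGroup V] [Module k V] [FiniteDimensional k V] [Finite κ]
    (W : κ → Submodule k V) (r d : ℕ)
    (hW : ∀ i, Module.finrank k (W i) ≤ r) (hd : d + r ≤ Module.finrank k V) :
    ∃ Y : Submodule k V, Module.finrank k Y = d ∧ ∀ i, Disjoint Y (W i) := by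
  induction d with
  | zero => exact ⟨⊥, by simp, fun i ↦ disjoint_bot_left⟩
  | succ d ih =>
    obtain ⟨Y, hY, hdisj⟩ := ih (by omega)
    -- `none` stands for the subspace `Y` itself, which matters when `κ` is empty
    let U : Option κ → Submodule k V := fun o ↦ o.elim Y (fun i ↦ Y ⊔ W i)
    have hU : ⋃ o, (U o : Set V) ≠ Set.univ := by
      intro h
      obtain ⟨o, ho⟩ := Subspace.exists_eq_top_of_iUnion_eq_univ h
      have hlt : Module.finrank k (U o) < Module.finrank k V := by
        rcases o with _ | i
        · change Module.finrank k Y < _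
          omega
        · have := Submodule.finrank_add_le_finrank_add_finrank Y (W i)
          have := hW i
          change Module.finrank k (Y ⊔ W i : Submodule k V) < _
          omega
      rw [ho, finrank_top] at hlt
      exact lt_irrefl _ hlt
    obtain ⟨v, hv⟩ := (Set.ne_univ_iff_exists_notMem _).mp hU
    rw [Set.mem_iUnion, not_exists] at hv
    have hvY : v ∉ Y := hv none
    refine ⟨Y ⊔ Submodule.span k {v}, ?_, fun i ↦ ?_⟩
    · have hv0 : v ≠ 0 := fun h ↦ hvY (h ▸ Y.zero_mem)
      have h1 := Submodule.finrank_sup_add_finrank_inf_eq Y (Submodule.span k {v})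
      have h2 : Y ⊓ Submodule.span k {v} = ⊥ :=
        ((Submodule.disjoint_span_singleton' hv0).mpr hvY).eq_bot
      rw [h2, finrank_bot, finrank_span_singleton hv0] at h1
      omega
    · rw [Submodule.disjoint_def]
      intro x hx hxW
      obtain ⟨y, hy, z, hz, rfl⟩ := Submodule.mem_sup.mp hx
      obtain ⟨a, rfl⟩ := Submodule.mem_span_singleton.mp hz
      rcases eq_or_ne a 0 with rfl | ha
      · rw [zero_smul, add_zero] at hxW ⊢
        exact Submodule.disjoint_def.mp (hdisj i) y hy hxW
      · refine absurd ?_ (hv (some i))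
        have : v = a⁻¹ • (-y + (y + a • v)) := by
          rw [neg_add_cancel_left, inv_smul_smul₀ ha]
        change v ∈ Y ⊔ W i
        rw [this]
        exact Submodule.smul_mem _ _ (Submodule.add_mem_sup (neg_mem hy) hxW)

theorem exists_linearIndependent_sumElim {k V κ : Type*} [Field k] [Infinite k]
    [AddCommGroup V] [Module k V] [FiniteDimensional k V] [Finite κ] {r d : ℕ}
    {w : κ → Fin r → V} (hw : ∀ x, LinearIndependent k (w x))
    (hd : d + r ≤ Module.finrank k V) :
    ∃ y : Fin d → V, ∀ x, LinearIndependent k (Sum.elim (w x) y) := by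
  obtain ⟨Y, hY, hdisj⟩ := Submodule.exists_disjoint_of_finrank_add_le
    (fun x ↦ Submodule.span k (Set.range (w x))) r d
    (fun x ↦ by rw [finrank_span_eq_card (hw x), Fintype.card_fin]) hd
  let c := Module.finBasisOfFinrankEq k Y hY
  refine ⟨fun s ↦ c s, fun x ↦ (hw x).sum_type
    (c.linearIndependent.map' Y.subtype (Submodule.ker_subtype Y))
    ((hdisj x).symm.mono_right (Submodule.span_le.mpr ?_))⟩
  rintro _ ⟨s, rfl⟩
  exact (c s).2

namespace MvPolynomial

variable {k ι σ : Type*} [Field k]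

/-- A basis of the space of linear forms is a system of coordinates. -/
theorem bijective_aeval_basis {τ : Type*}
    (b : Module.Basis τ k (homogeneousSubmodule ι k 1)) :
    Function.Bijective (aeval (R := k) fun j ↦ (b j : MvPolynomial ι k)) := by
  let ξ : ι → homogeneousSubmodule ι k 1 := fun i ↦ ⟨X i, isHomogeneous_X k i⟩
  let φ : homogeneousSubmodule ι k 1 →ₗ[k] MvPolynomial τ k := b.constr k X
  let ψ' : MvPolynomial ι k →ₐ[k] MvPolynomial τ k := aeval fun i ↦ φ (ξ i)
  have hψ' : ∀ v : homogeneousSubmodule ι k 1, ψ' v = φ v := by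
    have hξ : Submodule.span k (Set.range ξ) = ⊤ := by
      apply Submodule.map_injective_of_injective
        (homogeneousSubmodule ι k 1).injective_subtype
      rw [Submodule.map_span, Submodule.map_subtype_top, ← Set.range_comp]
      exact homogeneousSubmodule_one_eq_span_X.symm
    have : ψ'.toLinearMap ∘ₗ (homogeneousSubmodule ι k 1).subtype = φ :=
      LinearMap.ext_on_range hξ fun i ↦ by simp [ψ', ξ]
    exact fun v ↦ LinearMap.congr_fun this v
  refine Function.bijective_iff_has_inverse.mpr ⟨ψ', fun q ↦ ?_, fun q ↦ ?_⟩
  · change (ψ'.comp (aeval (R := k) fun j ↦ (b j : MvPolynomial ι k))) q = AlgHom.id k _ q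
    congr 1
    ext1 j
    simp only [AlgHom.comp_apply, aeval_X, AlgHom.id_apply]
    rw [hψ', b.constr_basis]
  · change ((aeval (R := k) fun j ↦ (b j : MvPolynomial ι k)).comp ψ') q = AlgHom.id k _ q
    congr 1
    ext1 i
    have h : (aeval (R := k) fun j ↦ (b j : MvPolynomial ι k)).toLinearMap ∘ₗ φ =
        (homogeneousSubmodule ι k 1).subtype := b.ext fun j ↦ by
      rw [LinearMap.comp_apply, b.constr_basis, AlgHom.toLinearMap_apply, aeval_X]
      rfl
    simpa [ψ'] using LinearMap.congr_fun h (ξ i)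

theorem exists_algEquiv_of_basis [Finite σ] [Algebra (MvPolynomial σ k) (MvPolynomial ι k)]
    (b : Module.Basis (Fin 2 ⊕ σ) k (homogeneousSubmodule ι k 1))
    (h : ∀ q, algebraMap (MvPolynomial σ k) (MvPolynomial ι k) q =
      aeval (fun s ↦ (b (.inr s) : MvPolynomial ι k)) q) :
    ∃ e : MvPolynomial (Fin 2) (MvPolynomial σ k) ≃ₐ[MvPolynomial σ k] MvPolynomial ι k,
      e (X 0) = b (.inl 0) ∧ e (X 1) = b (.inl 1) := by
  let ψ := AlgEquiv.ofBijective _ (bijective_aeval_basis b)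
  let e := (sumAlgEquiv k (Fin 2) σ).symm.trans ψ
  have hX : ∀ i, e (X i) = b (.inl i) := fun i ↦ by simp [e, ψ]
  refine ⟨AlgEquiv.ofRingEquiv (f := e.toRingEquiv) fun q ↦ ?_, hX 0, hX 1⟩
  rw [h]
  change e (C q) = _
  induction q using MvPolynomial.induction_on with
  | C a =>
    simp only [e, AlgEquiv.trans_apply, sumAlgEquiv_symm_C_C]
    rw [← algebraMap_eq, ψ.commutes, ← algebraMap_eq, AlgHom.commutes]
  | add p q hp hq => rw [C_add, map_add, map_add, hp, hq]
  | mul_X p s hp =>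
    rw [C_mul, map_mul, map_mul, hp]
    congr 1
    simp [e, ψ]

/-- A linear form in the ideal generated by two members of a basis of the space of linear forms is a
linear combination of these two. -/
theorem mem_span_of_mem_ideal_span [Finite σ] [Algebra (MvPolynomial σ k) (MvPolynomial ι k)]
    [IsScalarTower k (MvPolynomial σ k) (MvPolynomial ι k)]
    (b : Module.Basis (Fin 2 ⊕ σ) k (homogeneousSubmodule ι k 1))
    (h : ∀ s, algebraMap (MvPolynomial σ k) (MvPolynomial ι k) (X s) = b (.inr s))
    (e : MvPolynomial (Fin 2) (MvPolynomial σ k) ≃ₐ[MvPolynomial σ k] MvPolynomial ι k)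
    (h₀ : e (X 0) = b (.inl 0)) (h₁ : e (X 1) = b (.inl 1)) {N : MvPolynomial ι k}
    (hN : N.IsHomogeneous 1) (hp : N ∈ Ideal.span {e (X 0), e (X 1)}) :
    N ∈ Submodule.span k {e (X 0), e (X 1)} := by
  have := Fintype.ofFinite σ
  rw [span_pair_eq_ker, RingHom.mem_ker] at hp
  have hsum : N = ∑ j, b.repr ⟨N, hN⟩ j • (b j : MvPolynomial ι k) := by
    have := congr_arg Subtype.val (b.sum_repr ⟨N, hN⟩)
    rw [Submodule.coe_sum] at this
    exact this.symm
  set c := b.repr ⟨N, hN⟩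
  rw [Fintype.sum_sum_type, Fin.sum_univ_two, ← h₀, ← h₁] at hsum
  have hret : retraction e N = ∑ s, c (.inr s) • (X s : MvPolynomial σ k) := by
    let ρ := (retraction e).restrictScalars k
    have hρ : ∀ i, ρ (e (X i)) = 0 := fun i ↦ by simp [ρ, retraction]
    have hρ' : ∀ s, ρ (b (.inr s)) = X s := fun s ↦ by
      rw [← h]; exact (retraction e).commutes (X s)
    change ρ N = _
    rw [hsum]
    simp [hρ, hρ']
  rw [hp] at hret
  have hc := Fintype.linearIndependent_iff.mp (linearIndependent_X σ k) _ hret.symm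
  rw [hsum]
  simp only [hc, zero_smul, Finset.sum_const_zero, add_zero]
  exact Submodule.mem_span_pair.mpr ⟨_, _, rfl⟩

end MvPolynomial

/-! ### Local Jacobian ideals at the flats -/

namespace MvPolynomial

variable {k ι : Type*} [Field k]

variable (k) in
/-- Any two distinct members `L`, `M` of `forms` are part of a system of coordinates of the
polynomial ring over `S`: there is an isomorphism with `S[x, y]` which identifies `L` and `M` with
the variables. The members of `forms` in the ideal generated by `L` and `M` are moreover linear
combinations of `L` and `M`. -/
def HasFlatCharts (S : Type*) [CommRing S] [Algebra S (MvPolynomial ι k)]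
    (forms : Finset (MvPolynomial ι k)) : Prop :=
  ∀ L ∈ forms, ∀ M ∈ forms, L ≠ M →
    ∃ e : MvPolynomial (Fin 2) S ≃ₐ[S] MvPolynomial ι k, e (X 0) = L ∧ e (X 1) = M ∧
      ∀ N ∈ forms, N ∈ Ideal.span {L, M} → N ∈ Submodule.span k {L, M}

theorem finrank_homogeneousSubmodule_one [Fintype ι] :
    Module.finrank k (homogeneousSubmodule ι k 1) = Fintype.card ι := by
  rw [homogeneousSubmodule_one_eq_span_X, finrank_span_eq_card (linearIndependent_X ι k)]

instance finiteDimensional_homogeneousSubmodule_one [Finite ι] :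
    FiniteDimensional k (homogeneousSubmodule ι k 1) := by
  have := Fintype.ofFinite ι
  rw [homogeneousSubmodule_one_eq_span_X]
  exact FiniteDimensional.span_of_finite k (Set.finite_range _)

/-- General linear forms `y` complete any two members of `forms` to a basis of the space of linear
forms, so one polynomial subring `k[y]` serves all flats. -/
theorem exists_hasFlatCharts [Fintype ι] [Infinite k] {forms : Finset (MvPolynomial ι k)}
    (hom : ∀ L ∈ forms, L.IsHomogeneous 1)
    (hind : ∀ L ∈ forms, ∀ M ∈ forms, L ≠ M → LinearIndependent k ![L, M])
    {d : ℕ} (hd : d + 2 = Fintype.card ι) :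
    ∃ y : Fin d → MvPolynomial ι k, (∀ s, (y s).IsHomogeneous 1) ∧
      letI : Algebra (MvPolynomial (Fin d) k) (MvPolynomial ι k) := (aeval y).toAlgebra
      HasFlatCharts k (MvPolynomial (Fin d) k) forms := by
  let V := homogeneousSubmodule ι k 1
  let κ := {x : forms × forms // (x.1 : MvPolynomial ι k) ≠ x.2}
  let w : κ → Fin 2 → V := fun x ↦ ![⟨x.1.1, hom _ x.1.1.2⟩, ⟨x.1.2, hom _ x.1.2.2⟩]
  have hw : ∀ x, LinearIndependent k (w x) := fun x ↦ by
    refine LinearIndependent.of_comp V.subtype ?_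
    have : V.subtype ∘ w x = ![(x.1.1 : MvPolynomial ι k), x.1.2] := by
      ext1 i
      fin_cases i <;> rfl
    rw [this]
    exact hind x.1.1 x.1.1.2 x.1.2 x.1.2.2 x.2
  obtain ⟨y, hy⟩ := exists_linearIndependent_sumElim (d := d) hw
    (by rw [finrank_homogeneousSubmodule_one, hd])
  refine ⟨fun s ↦ y s, fun s ↦ (y s).2, ?_⟩
  let : Algebra (MvPolynomial (Fin d) k) (MvPolynomial ι k) :=
    (aeval fun s ↦ (y s : MvPolynomial ι k)).toAlgebra
  have : IsScalarTower k (MvPolynomial (Fin d) k) (MvPolynomial ι k) :=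
    IsScalarTower.of_algebraMap_eq fun a ↦ (AlgHom.commutes _ a).symm
  intro L hL M hM hLM
  let x : κ := ⟨(⟨L, hL⟩, ⟨M, hM⟩), hLM⟩
  let b : Module.Basis (Fin 2 ⊕ Fin d) k V := basisOfLinearIndependentOfCardEqFinrank (hy x)
    (by rw [finrank_homogeneousSubmodule_one, ← hd]; simp [add_comm])
  have hb₀ : (b (.inl 0) : MvPolynomial ι k) = L := by simp [b, w, x]
  have hb₁ : (b (.inl 1) : MvPolynomial ι k) = M := by simp [b, w, x]
  have hb₂ : ∀ s, b (.inr s) = y s := fun s ↦ by simp [b]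
  obtain ⟨e, he₀, he₁⟩ := exists_algEquiv_of_basis b fun q ↦ by
    simp_rw [hb₂]; rfl
  refine ⟨e, he₀.trans hb₀, he₁.trans hb₁, fun N hN hNp ↦ ?_⟩
  rw [← hb₀, ← hb₁, ← he₀, ← he₁] at hNp ⊢
  refine mem_span_of_mem_ideal_span b (fun s ↦ ?_) e he₀ he₁ (hom N hN) hNp
  rw [hb₂]
  exact aeval_X _ s

theorem isRelPrime_coordinates {S R : Type*} [CommRing S] [IsDomain S] [CommRing R] [Algebra S R]
    (e : MvPolynomial (Fin 2) S ≃ₐ[S] R) : IsRelPrime (e (X 0)) (e (X 1)) := by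
  have : IsDomain R := e.toRingEquiv.symm.toMulEquiv.isDomain
  have hX : Prime (e (X 0)) := (MulEquiv.prime_iff e.toMulEquiv).mpr X_prime
  rw [hX.irreducible.isRelPrime_iff_not_dvd, map_dvd_iff, X_dvd_X]
  simp

theorem _root_.Ideal.eq_of_le_of_height_eq_two {R : Type*} [CommRing R] [IsNoetherianRing R]
    {p q : Ideal R} [p.IsPrime] [q.IsPrime] (h : p ≤ q) (hp : p.height = 2) (hq : q.height = 2) :
    p = q := by
  by_contra hne
  have := Ideal.height_add_one_le_of_lt_of_isPrime (lt_of_le_of_ne h hne)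
  rw [hp, hq] at this
  exact absurd this (by decide)

section FlatCharts

variable {forms : Finset (MvPolynomial ι k)} {L M : MvPolynomial ι k}

open Classical in
/-- The ideal generated by the partial derivatives of the product of those members of `forms` which
lie in `p`. -/
noncomputable def localJacobian (forms : Finset (MvPolynomial ι k))
    (p : Ideal (MvPolynomial ι k)) : Ideal (MvPolynomial ι k) :=
  jacobian (∏ N ∈ forms.filter (· ∈ p), N)

open Classical in
theorem localJacobian_le_of_three_le {p : Ideal (MvPolynomial ι k)}
    (h3 : 3 ≤ (forms.filter (· ∈ p)).card) : localJacobian forms p ≤ p ^ 2 := by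
  exact jacobian_prod_le_sq (fun L hL ↦ (Finset.mem_filter.mp hL).2) h3

open Classical in
theorem filter_nonempty (hL : L ∈ forms) :
    (forms.filter (· ∈ Ideal.span {L, M})).Nonempty :=
  ⟨L, Finset.mem_filter.mpr ⟨hL, Ideal.left_mem_span_pair _ _⟩⟩

open Classical in
theorem filter_eq_pair_of_card_lt (hL : L ∈ forms) (hM : M ∈ forms) (hLM : L ≠ M)
    (h3 : (forms.filter (· ∈ Ideal.span {L, M})).card < 3) :
    forms.filter (· ∈ Ideal.span {L, M}) = {L, M} := by
  symm
  refine Finset.eq_of_subset_of_card_le ?_ (by rw [Finset.card_pair hLM]; omega)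
  intro N hN
  rcases Finset.mem_insert.mp hN with rfl | hN
  · exact Finset.mem_filter.mpr ⟨hL, Ideal.left_mem_span_pair _ _⟩
  · rw [Finset.mem_singleton.mp hN]
    exact Finset.mem_filter.mpr ⟨hM, Ideal.right_mem_span_pair _ _⟩

namespace HasFlatCharts

section

variable {S : Type*} [CommRing S] [Algebra k S] [Algebra S (MvPolynomial ι k)]
  [IsScalarTower k S (MvPolynomial ι k)]

open Classical in
theorem localJacobian_eq_of_card_lt [Fintype ι] (h : HasFlatCharts k S forms) (hL : L ∈ forms)
    (hM : M ∈ forms) (hLM : L ≠ M) (h3 : (forms.filter (· ∈ Ideal.span {L, M})).card < 3) :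
    localJacobian forms (Ideal.span {L, M}) = Ideal.span {L, M} := by
  rw [localJacobian, filter_eq_pair_of_card_lt hL hM hLM h3, Finset.prod_pair hLM]
  obtain ⟨e, rfl, rfl, -⟩ := h L hL M hM hLM
  exact jacobian_mul_eq e

theorem isFiniteProjectiveQuotient_pow (h : HasFlatCharts k S forms) (hL : L ∈ forms)
    (hM : M ∈ forms) (hLM : L ≠ M) (m : ℕ) :
    IsFiniteProjectiveQuotient S (Ideal.span {L, M} ^ m) := by
  obtain ⟨e, rfl, rfl, -⟩ := h L hL M hM hLM
  exact isFiniteProjectiveQuotient_span_pair_pow (k := k) e m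

end

variable {S : Type*} [CommRing S] [IsDomain S] [Algebra S (MvPolynomial ι k)]

theorem isPrime (h : HasFlatCharts k S forms) (hL : L ∈ forms) (hM : M ∈ forms) (hLM : L ≠ M) :
    (Ideal.span {L, M}).IsPrime := by
  obtain ⟨e, rfl, rfl, -⟩ := h L hL M hM hLM
  exact isPrime_span_pair e

theorem height_eq [Finite ι] (h : HasFlatCharts k S forms) (hL : L ∈ forms) (hM : M ∈ forms)
    (hLM : L ≠ M) : (Ideal.span {L, M}).height = 2 := by
  obtain ⟨e, rfl, rfl, -⟩ := h L hL M hM hLM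
  exact height_span_pair e

theorem span_pair_eq_of_le [Finite ι] (h : HasFlatCharts k S forms) (hL : L ∈ forms)
    (hM : M ∈ forms) (hLM : L ≠ M) {P : Ideal (MvPolynomial ι k)} [P.IsPrime] (hP : P.height = 2)
    (hLP : L ∈ P)
    (hMP : M ∈ P) : Ideal.span {L, M} = P := by
  have := h.isPrime hL hM hLM
  refine Ideal.eq_of_le_of_height_eq_two (Ideal.span_le.mpr ?_) (h.height_eq hL hM hLM) hP
  exact Set.pair_subset hLP hMP


theorem span_eq [Finite ι] (h : HasFlatCharts k S forms) (hL : L ∈ forms) (hM : M ∈ forms)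
    (hLM : L ≠ M) {L' M' : MvPolynomial ι k} (hL' : L' ∈ forms) (hM' : M' ∈ forms) (hne : L' ≠ M')
    (hL'p : L' ∈ Ideal.span {L, M}) (hM'p : M' ∈ Ideal.span {L, M}) :
    Ideal.span {L', M'} = Ideal.span {L, M} :=
  have := h.isPrime hL hM hLM
  h.span_pair_eq_of_le hL' hM' hne (h.height_eq hL hM hLM) hL'p hM'p

theorem radical_localJacobian_le [Fintype ι] [CharZero k] (h : HasFlatCharts k S forms)
    (hom : ∀ L ∈ forms, L.IsHomogeneous 1) (h0 : ∀ L ∈ forms, L ≠ 0) (hL : L ∈ forms)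
    (hM : M ∈ forms) (hLM : L ≠ M) :
    Ideal.span {L, M} ≤ (localJacobian forms (Ideal.span {L, M})).radical := by
  classical
  rw [Ideal.radical_eq_sInf]
  refine le_sInf ?_
  rintro P ⟨hJP, hP⟩
  obtain ⟨L', hL', M', hM', hne, hL'P, hM'P⟩ := exists_pair_mem_of_jacobian_le
    (fun N hN ↦ hom N (Finset.mem_of_mem_filter N hN))
    (fun N hN ↦ h0 N (Finset.mem_of_mem_filter N hN)) (filter_nonempty hL) hJP
  obtain ⟨hL', hL'p⟩ := Finset.mem_filter.mp hL'
  obtain ⟨hM', hM'p⟩ := Finset.mem_filter.mp hM'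
  rw [← h.span_eq hL hM hLM hL' hM' hne hL'p hM'p]
  exact Ideal.span_le.mpr (Set.pair_subset hL'P hM'P)

theorem exists_pow_le_localJacobian [Fintype ι] [CharZero k] (h : HasFlatCharts k S forms)
    (hom : ∀ L ∈ forms, L.IsHomogeneous 1) (h0 : ∀ L ∈ forms, L ≠ 0) (hL : L ∈ forms)
    (hM : M ∈ forms) (hLM : L ≠ M) :
    ∃ N, Ideal.span {L, M} ^ N ≤ localJacobian forms (Ideal.span {L, M}) := by
  obtain ⟨N, hN⟩ := (localJacobian forms (Ideal.span {L, M})).exists_radical_pow_le_of_fg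
    (IsNoetherian.noetherian _)
  exact ⟨N, (Ideal.pow_right_mono (h.radical_localJacobian_le hom h0 hL hM hLM) N).trans hN⟩

theorem mem_of_mul_mem (h : HasFlatCharts k S forms) (hL : L ∈ forms)
    (hM : M ∈ forms) (hLM : L ≠ M) {I : Ideal (MvPolynomial ι k)}
    (hI : IsFiniteProjectiveQuotient S I) {m : ℕ} (hm : Ideal.span {L, M} ^ m ≤ I)
    {s u : MvPolynomial ι k} (hs : s ∉ Ideal.span {L, M}) (hu : u * s ∈ I) : u ∈ I := by
  obtain ⟨e, rfl, rfl, -⟩ := h L hL M hM hLM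
  exact mem_of_mul_mem_of_pow_le e hI hm hs hu

variable [Algebra k S] [IsScalarTower k S (MvPolynomial ι k)]

theorem isFiniteProjectiveQuotient_localJacobian [Fintype ι] [CharZero k]
    (h : HasFlatCharts k S forms)
    (hom : ∀ L ∈ forms, L.IsHomogeneous 1) (h0 : ∀ L ∈ forms, L ≠ 0) (hL : L ∈ forms)
    (hM : M ∈ forms) (hLM : L ≠ M) :
    IsFiniteProjectiveQuotient S (localJacobian forms (Ideal.span {L, M})) := by
  classical
  obtain ⟨m, hm⟩ := h.exists_pow_le_localJacobian hom h0 hL hM hLM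
  obtain ⟨e, he₀, he₁, hspan⟩ := h L hL M hM hLM
  rw [localJacobian, jacobian] at hm ⊢
  set G := ∏ N ∈ forms.filter (· ∈ Ideal.span {L, M}), N with hG
  refine isFiniteProjectiveQuotient_span_of_mem_adjoin (k := k) e ?_ (by rwa [he₀, he₁])
  rintro _ ⟨i, rfl⟩
  rw [he₀, he₁]
  refine pderiv_mem_adjoin (by simp [hom L hL, hom M hM]) ?_ i
  refine Subalgebra.prod_mem _ fun N hN ↦ ?_
  obtain ⟨hN, hNp⟩ := Finset.mem_filter.mp hN
  exact Algebra.span_le_adjoin k _ (hspan N hN hNp)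

open Classical in
/-- In the presence of charts, attaching ideals to the flats requires of each `c p` only that it
has a finite projective quotient, contains a power of `p` and the product of the forms in `p`, and
equals `p` if `p` contains only two forms. -/
theorem flatSystem [Finite ι] (h : HasFlatCharts k S forms)
    {c : Ideal (MvPolynomial ι k) → Ideal (MvPolynomial ι k)}
    (hc₂ : ∀ L ∈ forms, ∀ M ∈ forms, L ≠ M →
      (forms.filter (· ∈ Ideal.span {L, M})).card < 3 → c (Ideal.span {L, M}) = Ideal.span {L, M})
    (hc : ∀ L ∈ forms, ∀ M ∈ forms, L ≠ M →
      IsFiniteProjectiveQuotient S (c (Ideal.span {L, M})))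
    (hpow : ∀ L ∈ forms, ∀ M ∈ forms, L ≠ M → ∃ m, Ideal.span {L, M} ^ m ≤ c (Ideal.span {L, M}))
    (hprod : ∀ L ∈ forms, ∀ M ∈ forms, L ≠ M →
      ∏ f ∈ forms.filter (· ∈ Ideal.span {L, M}), f ∈ c (Ideal.span {L, M}))
    (huniq : ∀ L ∈ forms, ∀ M ∈ forms, L ≠ M → ∀ M' ∈ forms, L ≠ M' →
      3 ≤ (forms.filter (· ∈ Ideal.span {L, M})).card →
      3 ≤ (forms.filter (· ∈ Ideal.span {L, M'})).card →
        Ideal.span {L, M} = Ideal.span {L, M'}) :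
    FlatSystem S forms c where
  isRelPrime L hL M hM hLM := by
    obtain ⟨e, rfl, rfl, -⟩ := h L hL M hM hLM
    exact isRelPrime_coordinates e
  isPrime L hL M hM hLM := h.isPrime hL hM hLM
  finite L hL M hM hLM := by
    simpa using h.isFiniteProjectiveQuotient_pow hL hM hLM 1
  span_eq L hL M hM hLM L' hL' M' hM' hne := h.span_eq hL hM hLM hL' hM' hne
  eq_self := hc₂
  finite_c := hc
  primary L hL M hM hLM s hs u hu := by
    obtain ⟨m, hm⟩ := hpow L hL M hM hLM
    exact h.mem_of_mul_mem hL hM hLM (hc L hL M hM hLM) hm hs hu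
  prod_mem := hprod
  unique := huniq

end HasFlatCharts
end FlatCharts
end MvPolynomial

/-! ### The height two components of the Jacobian ideal -/

theorem Ideal.height_radical {R : Type*} [CommRing R] (I : Ideal R) :
    I.radical.height = I.height := by
  simp only [Ideal.height, Ideal.radical_minimalPrimes]

theorem Submodule.IsMinimalPrimaryDecomposition.eq_of_radical_eq {R : Type*} [CommRing R]
    {I : Ideal R} {t : Finset (Ideal R)} (ht : Submodule.IsMinimalPrimaryDecomposition I t)
    {q q' : Ideal R} (hq : q ∈ t) (hq' : q' ∈ t) (h : q.radical = q'.radical) : q = q' := by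
  by_contra hne
  refine ht.distinct hq hq' hne ?_
  change (q.colon Set.univ).radical = (q'.colon Set.univ).radical
  rwa [Submodule.colon_univ, Submodule.colon_univ]

/-- If `R ⧸ I` is finite projective over a polynomial subring `S`, one variable of which lies in the
irrelevant ideal, then `I` is saturated, since that variable is a nonzerodivisor modulo `I`, and
`R ⧸ I` is Cohen-Macaulay. -/
theorem saturation_eq_and_isACM {k : Type*} [Field k] {n d : ℕ}
    [Algebra (MvPolynomial (Fin d) k) (MvPolynomial (Fin (n + 1)) k)] (s : Fin d)
    (hs : algebraMap (MvPolynomial (Fin d) k) (MvPolynomial (Fin (n + 1)) k) (X s) ∈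
      irrelevantIdeal k n) {I : Ideal (MvPolynomial (Fin (n + 1)) k)}
    (hI : IsFiniteProjectiveQuotient (MvPolynomial (Fin d) k) I) :
    saturation I = I ∧ IsACM I := by
  have hsat : saturation I = I := by
    have hle : I ≤ saturation I := fun u hu ↦ Submodule.mem_iSup_of_mem 0 (Ideal.le_colon hu)
    refine le_antisymm (iSup_le fun N u hu ↦ ?_) hle
    have h₁ := Submodule.mem_colon.mp hu _ (Ideal.pow_mem_pow hs N)
    rw [smul_eq_mul, mul_comm, ← map_pow] at h₁
    exact hI.mem_of_algebraMap_mul_mem (pow_ne_zero N (X_ne_zero s)) h₁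
  refine ⟨hsat, ?_⟩
  obtain ⟨_, _⟩ := hI
  rw [IsACM, hsat]
  exact isCohenMacaulayRing_of_finite_of_flat k d _

namespace HyperplaneArrangement

variable {k : Type*} [Field k] {n : ℕ} (A : HyperplaneArrangement k n)

open Classical in
theorem multiplicity_eq_card (p : Ideal (MvPolynomial (Fin (n + 1)) k)) :
    A.multiplicity p = (A.forms.filter (· ∈ p)).card := by
  rw [multiplicity, ← Set.ncard_coe_finset]
  congr 1
  ext
  simp

variable {A}

theorem isPrime_radical_of_mem {t : Finset (Ideal (MvPolynomial (Fin (n + 1)) k))}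
    (ht : Submodule.IsMinimalPrimaryDecomposition A.jacobianIdeal t)
    {q : Ideal (MvPolynomial (Fin (n + 1)) k)} (hq : q ∈ t) :
    q.radical.IsPrime ∧ A.jacobianIdeal ≤ q := by
  refine ⟨Ideal.isPrime_radical (ht.primary hq), ?_⟩
  rw [← ht.inf_eq]
  exact Finset.inf_le hq

open Classical in
theorem isFiniteProjectiveQuotient_inter_pow {S : Type*} [CommRing S] [IsDomain S] [Algebra k S]
    [Algebra S (MvPolynomial (Fin (n + 1)) k)] [IsScalarTower k S (MvPolynomial (Fin (n + 1)) k)]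
    (h : HasFlatCharts k S A.forms)
    (huniq : ∀ L ∈ A.forms, ∀ M ∈ A.forms, L ≠ M → ∀ M' ∈ A.forms, L ≠ M' →
      3 ≤ (A.forms.filter (· ∈ Ideal.span {L, M})).card →
      3 ≤ (A.forms.filter (· ∈ Ideal.span {L, M'})).card →
        Ideal.span {L, M} = Ideal.span {L, M'})
    (b : Ideal (MvPolynomial (Fin (n + 1)) k) → ℕ)
    (hb : ∀ L ∈ A.forms, ∀ M ∈ A.forms, L ≠ M →
      (A.multiplicity (Ideal.span {L, M}) = 2 → b (Ideal.span {L, M}) = 1) ∧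
        (3 ≤ A.multiplicity (Ideal.span {L, M}) →
          b (Ideal.span {L, M}) ≤ A.multiplicity (Ideal.span {L, M}))) :
    IsFiniteProjectiveQuotient S (FlatSystem.inter (fun p ↦ p ^ b p) A.forms) := by
  have hb₂ : ∀ L ∈ A.forms, ∀ M ∈ A.forms, L ≠ M →
      (A.forms.filter (· ∈ Ideal.span {L, M})).card < 3 → b (Ideal.span {L, M}) = 1 := by
    intro L hL M hM hLM h3
    refine (hb L hL M hM hLM).1 ?_
    rw [multiplicity_eq_card, filter_eq_pair_of_card_lt hL hM hLM h3]
    convert Finset.card_pair hLM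
  refine FlatSystem.finite_inter (h.flatSystem (c := fun p ↦ p ^ b p) ?_ ?_ ?_ ?_ huniq)
  · intro L hL M hM hLM h3
    change Ideal.span {L, M} ^ b (Ideal.span {L, M}) = _
    rw [hb₂ L hL M hM hLM h3, pow_one]
  · exact fun L hL M hM hLM ↦ h.isFiniteProjectiveQuotient_pow hL hM hLM _
  · exact fun L hL M hM hLM ↦ ⟨b (Ideal.span {L, M}), le_rfl⟩
  · intro L hL M hM hLM
    have hle : b (Ideal.span {L, M}) ≤ (A.forms.filter (· ∈ Ideal.span {L, M})).card := by
      rcases lt_or_ge (A.forms.filter (· ∈ Ideal.span {L, M})).card 3 with h3 | h3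
      · rw [hb₂ L hL M hM hLM h3]
        exact (filter_nonempty hL).card_pos
      · rw [← multiplicity_eq_card] at h3 ⊢
        exact (hb L hL M hM hLM).2 h3
    refine Ideal.pow_le_pow_right hle ?_
    rw [← Finset.prod_const]
    exact Ideal.prod_mem_prod fun N hN ↦ (Finset.mem_filter.mp hN).2

variable [CharZero k]

theorem exists_pair_mem (hne : A.forms.Nonempty) {P : Ideal (MvPolynomial (Fin (n + 1)) k)}
    [P.IsPrime] (hP : A.jacobianIdeal ≤ P) : ∃ L ∈ A.forms, ∃ M ∈ A.forms, L ≠ M ∧ L ∈ P ∧ M ∈ P :=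
  exists_pair_mem_of_jacobian_le A.isHomogeneous A.ne_zero hne hP

variable {S : Type*} [CommRing S] [Algebra S (MvPolynomial (Fin (n + 1)) k)]

theorem jacobianIdeal_le_span_pair [Algebra k S]
    [IsScalarTower k S (MvPolynomial (Fin (n + 1)) k)] (h : HasFlatCharts k S A.forms)
    {L M : MvPolynomial (Fin (n + 1)) k}
    (hL : L ∈ A.forms) (hM : M ∈ A.forms) (hLM : L ≠ M) :
    A.jacobianIdeal ≤ Ideal.span {L, M} := by
  classical
  have h₁ : jacobian A.poly ≤ jacobian (∏ N ∈ {L, M}, N) :=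
    jacobian_prod_le_jacobian_prod (by simp [A.isHomogeneous, hL, hM]) (by simp)
      (by simp [Finset.insert_subset_iff, hL, hM])
  rw [Finset.prod_pair hLM] at h₁
  obtain ⟨e, rfl, rfl, -⟩ := h L hL M hM hLM
  exact h₁.trans (jacobian_mul_eq e).le

variable [IsDomain S]

theorem radical_eq_of_le (h : HasFlatCharts k S A.forms)
    {t : Finset (Ideal (MvPolynomial (Fin (n + 1)) k))}
    (ht : Submodule.IsMinimalPrimaryDecomposition A.jacobianIdeal t)
    {q : Ideal (MvPolynomial (Fin (n + 1)) k)} (hq : q ∈ t) {L M : MvPolynomial (Fin (n + 1)) k}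
    (hL : L ∈ A.forms) (hM : M ∈ A.forms) (hLM : L ≠ M) (hle : q ≤ Ideal.span {L, M}) :
    q.radical = Ideal.span {L, M} := by
  have hp := h.isPrime hL hM hLM
  obtain ⟨hP, hJ⟩ := isPrime_radical_of_mem ht hq
  have hle' : q.radical ≤ Ideal.span {L, M} := hp.radical_le_iff.mpr hle
  obtain ⟨L', hL', M', hM', hne, hL'P, hM'P⟩ :=
    exists_pair_mem ⟨L, hL⟩ (hJ.trans Ideal.le_radical)
  refine le_antisymm hle' ?_
  rw [← h.span_eq hL hM hLM hL' hM' hne (hle' hL'P) (hle' hM'P)]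
  exact Ideal.span_le.mpr (Set.pair_subset hL'P hM'P)

/-- The radicals of the height two components are flats. -/
theorem exists_radical_eq (h : HasFlatCharts k S A.forms)
    {t : Finset (Ideal (MvPolynomial (Fin (n + 1)) k))}
    (ht : Submodule.IsMinimalPrimaryDecomposition A.jacobianIdeal t)
    {q : Ideal (MvPolynomial (Fin (n + 1)) k)} (hq : q ∈ heightTwoComponents t) :
    ∃ L ∈ A.forms, ∃ M ∈ A.forms, L ≠ M ∧ q.radical = Ideal.span {L, M} := by
  classical
  obtain ⟨hqt, hq2⟩ := hq
  obtain ⟨hP, hJ⟩ := isPrime_radical_of_mem ht hqt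
  rcases A.forms.eq_empty_or_nonempty with hA | hA
  · exfalso
    have hJ0 : A.jacobianIdeal = ⊥ := by simp [jacobianIdeal, poly, hA]
    have hbot : ⊥ ∈ t := by
      have hle : t.inf id ≤ ⊥ := (ht.inf_eq.trans hJ0).le
      obtain ⟨q', hq', hle⟩ := (Ideal.isPrime_bot.inf_le').mp hle
      rwa [← le_bot_iff.mp hle]
    rcases eq_or_ne q ⊥ with rfl | hne
    · simp at hq2
    · exact ht.minimal hqt ((Finset.inf_le (Finset.mem_erase.mpr ⟨hne.symm, hbot⟩)).trans bot_le)
  · obtain ⟨L, hL, M, hM, hLM, hLP, hMP⟩ := exists_pair_mem hA (hJ.trans Ideal.le_radical)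
    exact ⟨L, hL, M, hM, hLM,
      (h.span_pair_eq_of_le hL hM hLM (by rw [Ideal.height_radical, hq2]) hLP hMP).symm⟩

variable [Algebra k S] [IsScalarTower k S (MvPolynomial (Fin (n + 1)) k)]

/-- Every flat is the radical of a height two component. -/
theorem exists_mem_heightTwoComponents (h : HasFlatCharts k S A.forms)
    {t : Finset (Ideal (MvPolynomial (Fin (n + 1)) k))}
    (ht : Submodule.IsMinimalPrimaryDecomposition A.jacobianIdeal t)
    {L M : MvPolynomial (Fin (n + 1)) k}
    (hL : L ∈ A.forms) (hM : M ∈ A.forms) (hLM : L ≠ M) :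
    ∃ q ∈ heightTwoComponents t, q.radical = Ideal.span {L, M} := by
  have hle : t.inf id ≤ Ideal.span {L, M} :=
    ht.inf_eq.le.trans (jacobianIdeal_le_span_pair h hL hM hLM)
  obtain ⟨q, hq, hle⟩ := ((h.isPrime hL hM hLM).inf_le').mp hle
  have hrad := radical_eq_of_le h ht hq hL hM hLM hle
  exact ⟨q, ⟨hq, by rw [← Ideal.height_radical, hrad, h.height_eq hL hM hLM]⟩, hrad⟩

/-- The height two component with radical `p` is the Jacobian ideal of the product of the forms in
`p`: both are `p`-primary, and they agree after localization at `p`. -/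
theorem eq_localJacobian (h : HasFlatCharts k S A.forms)
    {t : Finset (Ideal (MvPolynomial (Fin (n + 1)) k))}
    (ht : Submodule.IsMinimalPrimaryDecomposition A.jacobianIdeal t)
    {q : Ideal (MvPolynomial (Fin (n + 1)) k)} (hq : q ∈ t)
    {L M : MvPolynomial (Fin (n + 1)) k}
    (hL : L ∈ A.forms) (hM : M ∈ A.forms) (hLM : L ≠ M) (hrad : q.radical = Ideal.span {L, M}) :
    q = localJacobian A.forms q.radical := by
  classical
  have hp := h.isPrime hL hM hLM
  rw [hrad]
  refine le_antisymm (fun u hu ↦ ?_) fun u hu ↦ ?_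
  · have hnot : ¬ (t.erase q).inf id ≤ Ideal.span {L, M} := fun hle ↦ by
      obtain ⟨q', hq', hle⟩ := (hp.inf_le').mp hle
      obtain ⟨hne, hq'⟩ := Finset.mem_erase.mp hq'
      exact hne (ht.eq_of_radical_eq hq' hq
        ((radical_eq_of_le h ht hq' hL hM hLM hle).trans hrad.symm))
    obtain ⟨s, hs, hsp⟩ := SetLike.not_le_iff_exists.mp hnot
    have hus : u * s ∈ A.jacobianIdeal := by
      rw [← ht.inf_eq, ← Finset.insert_erase hq, Finset.inf_insert]
      exact ⟨Ideal.mul_mem_right _ _ hu, Ideal.mul_mem_left _ _ hs⟩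
    have hle : A.jacobianIdeal ≤ localJacobian A.forms (Ideal.span {L, M}) :=
      jacobian_prod_le_jacobian_prod (fun N hN ↦ A.isHomogeneous N (Finset.mem_of_mem_filter N hN))
        (filter_nonempty hL) (Finset.filter_subset _ _)
    obtain ⟨m, hm⟩ := h.exists_pow_le_localJacobian A.isHomogeneous A.ne_zero hL hM hLM
    exact h.mem_of_mul_mem hL hM hLM
      (h.isFiniteProjectiveQuotient_localJacobian A.isHomogeneous A.ne_zero hL hM hLM) hm hsp
      (hle hus)
  · obtain ⟨e, he₀, he₁, hspan⟩ := h L hL M hM hLM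
    obtain ⟨s, hs, hsJ⟩ := exists_notMem_mul_jacobian_le e
      (T := A.forms.filter (· ∈ Ideal.span {L, M})) (U := A.forms.filter (· ∉ Ideal.span {L, M}))
      (fun N hN ↦ by
        rw [he₀, he₁]
        exact hspan N (Finset.mem_filter.mp hN).1 (Finset.mem_filter.mp hN).2)
      (fun N hN ↦ by rw [he₀, he₁]; exact (Finset.mem_filter.mp hN).2) (filter_nonempty hL)
    rw [he₀, he₁, ← hrad] at hs
    have h₁ := hsJ u hu
    rw [mul_comm (∏ N ∈ _, N), Finset.prod_filter_mul_prod_filter_not] at h₁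
    have h₂ : u * s ∈ q := by
      rw [mul_comm]
      exact (isPrime_radical_of_mem ht hq).2 h₁
    exact ((Ideal.isPrimary_iff.mp (ht.primary hq)).2 h₂).resolve_right hs

open Classical in
/-- A component whose flat `p` contains at least three forms is non-reduced, because it is contained
in `p ^ 2`. -/
theorem not_isRadical (h : HasFlatCharts k S A.forms)
    {t : Finset (Ideal (MvPolynomial (Fin (n + 1)) k))}
    (ht : Submodule.IsMinimalPrimaryDecomposition A.jacobianIdeal t)
    {q : Ideal (MvPolynomial (Fin (n + 1)) k)} (hq : q ∈ t)
    {L M : MvPolynomial (Fin (n + 1)) k}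
    (hL : L ∈ A.forms) (hM : M ∈ A.forms) (hLM : L ≠ M) (hrad : q.radical = Ideal.span {L, M})
    (h3 : 3 ≤ (A.forms.filter (· ∈ Ideal.span {L, M})).card) : ¬ q.IsRadical := by
  intro hr
  have hp := h.isPrime hL hM hLM
  have h₁ := eq_localJacobian h ht hq hL hM hLM hrad
  rw [hrad, ← hr.radical, hrad] at h₁
  have h₂ : Ideal.span {L, M} ≤ Ideal.span {L, M} ^ 2 :=
    h₁.le.trans (localJacobian_le_of_three_le h3)
  have h₃ : IsIdempotentElem (Ideal.span {L, M}) := by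
    rw [IsIdempotentElem, ← pow_two]
    exact le_antisymm (Ideal.pow_le_self two_ne_zero) h₂
  rcases (Ideal.isIdempotentElem_iff_eq_bot_or_top _ (IsNoetherian.noetherian _)).mp h₃ with h₄ | h₄
  · have := Ideal.left_mem_span_pair L M
    rw [h₄] at this
    exact A.ne_zero L hL this
  · exact hp.ne_top h₄

/-- Any family of ideals attached to the radicals of the height two components is a family attached
to the flats. -/
theorem iInf_heightTwoComponents (h : HasFlatCharts k S A.forms)
    {t : Finset (Ideal (MvPolynomial (Fin (n + 1)) k))}
    (ht : Submodule.IsMinimalPrimaryDecomposition A.jacobianIdeal t)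
    (c : Ideal (MvPolynomial (Fin (n + 1)) k) → Ideal (MvPolynomial (Fin (n + 1)) k)) :
    ⨅ q ∈ heightTwoComponents t, c q.radical = FlatSystem.inter c A.forms := by
  refine le_antisymm ?_ ?_
  · refine le_iInf₂ fun L hL ↦ le_iInf₂ fun M hM ↦ le_iInf fun hLM ↦ ?_
    obtain ⟨q, hq, hrad⟩ := exists_mem_heightTwoComponents h ht hL hM hLM
    rw [← hrad]
    exact iInf₂_le q hq
  · refine le_iInf₂ fun q hq ↦ ?_
    obtain ⟨L, hL, M, hM, hLM, hrad⟩ := exists_radical_eq h ht hq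
    rw [hrad]
    exact (iInf₂_le L hL).trans ((iInf₂_le M hM).trans (iInf_le _ hLM))

theorem topDimensionalPart_eq (h : HasFlatCharts k S A.forms)
    {t : Finset (Ideal (MvPolynomial (Fin (n + 1)) k))}
    (ht : Submodule.IsMinimalPrimaryDecomposition A.jacobianIdeal t) :
    topDimensionalPart t = FlatSystem.inter (localJacobian A.forms) A.forms := by
  rw [← iInf_heightTwoComponents h ht]
  refine iInf_congr fun q ↦ iInf_congr fun hq ↦ ?_
  obtain ⟨L, hL, M, hM, hLM, hrad⟩ := exists_radical_eq h ht hq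
  exact eq_localJacobian h ht hq.1 hL hM hLM hrad

theorem radical_jacobianIdeal_eq (h : HasFlatCharts k S A.forms) (hne : A.forms.Nonempty) :
    A.jacobianIdeal.radical = FlatSystem.inter (fun p ↦ p ^ 1) A.forms := by
  refine le_antisymm ?_ ?_
  · refine le_iInf₂ fun L hL ↦ le_iInf₂ fun M hM ↦ le_iInf fun hLM ↦ ?_
    change _ ≤ Ideal.span {L, M} ^ 1
    rw [pow_one, (h.isPrime hL hM hLM).radical_le_iff]
    exact jacobianIdeal_le_span_pair h hL hM hLM
  · rw [Ideal.radical_eq_sInf]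
    refine le_sInf ?_
    rintro P ⟨hJ, hP⟩
    obtain ⟨L, hL, M, hM, hLM, hLP, hMP⟩ := exists_pair_mem hne hJ
    refine (iInf₂_le L hL).trans ((iInf₂_le M hM).trans ((iInf_le _ hLM).trans ?_))
    change Ideal.span {L, M} ^ 1 ≤ P
    rw [pow_one]
    exact Ideal.span_le.mpr (Set.pair_subset hLP hMP)

open Classical in
theorem isFiniteProjectiveQuotient_inter_localJacobian (h : HasFlatCharts k S A.forms)
    (huniq : ∀ L ∈ A.forms, ∀ M ∈ A.forms, L ≠ M → ∀ M' ∈ A.forms, L ≠ M' →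
      3 ≤ (A.forms.filter (· ∈ Ideal.span {L, M})).card →
      3 ≤ (A.forms.filter (· ∈ Ideal.span {L, M'})).card →
        Ideal.span {L, M} = Ideal.span {L, M'}) :
    IsFiniteProjectiveQuotient S (FlatSystem.inter (localJacobian A.forms) A.forms) :=
  (h.flatSystem (fun _ hL _ hM hLM h3 ↦ h.localJacobian_eq_of_card_lt hL hM hLM h3)
    (fun _ hL _ hM hLM ↦
      h.isFiniteProjectiveQuotient_localJacobian A.isHomogeneous A.ne_zero hL hM hLM)
    (fun _ hL _ hM hLM ↦ h.exists_pow_le_localJacobian A.isHomogeneous A.ne_zero hL hM hLM)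
    (fun _ hL _ _ _ ↦ prod_mem_jacobian
      (fun N hN ↦ A.isHomogeneous N (Finset.mem_of_mem_filter N hN)) (filter_nonempty hL))
    huniq).finite_inter

end HyperplaneArrangement

theorem corollary3p6 {k : Type*} [Field k] [CharZero k] (n : ℕ) (hn : 3 ≤ n)
    (A : HyperplaneArrangement k n)
    (t : Finset (Ideal (MvPolynomial (Fin (n + 1)) k)))
    (ht : Submodule.IsMinimalPrimaryDecomposition A.jacobianIdeal t)
    (hA : ∀ L ∈ A.forms, ∀ q ∈ heightTwoComponents t, ∀ q' ∈ heightTwoComponents t,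
      ¬ q.IsRadical → ¬ q'.IsRadical → L ∈ q.radical → L ∈ q'.radical → q = q') :
    (saturation (topDimensionalPart t) = topDimensionalPart t ∧ IsACM (topDimensionalPart t)) ∧
    (saturation A.jacobianIdeal.radical = A.jacobianIdeal.radical ∧
      IsACM A.jacobianIdeal.radical) ∧
    ∀ b : Ideal (MvPolynomial (Fin (n + 1)) k) → ℕ,
      (∀ q ∈ heightTwoComponents t,
        (A.multiplicity q.radical = 2 → b q.radical = 1) ∧
        (3 ≤ A.multiplicity q.radical → b q.radical ≤ A.multiplicity q.radical)) →
      saturation (fatIdeal t b) = fatIdeal t b ∧ IsACM (fatIdeal t b) := by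
  classical
  obtain ⟨y, hy, h⟩ := exists_hasFlatCharts (d := n - 1) A.isHomogeneous
    (fun L hL M hM hLM ↦ A.pairwise_independent hL hM hLM) (by rw [Fintype.card_fin]; omega)
  let : Algebra (MvPolynomial (Fin (n - 1)) k) (MvPolynomial (Fin (n + 1)) k) := (aeval y).toAlgebra
  have : IsScalarTower k (MvPolynomial (Fin (n - 1)) k) (MvPolynomial (Fin (n + 1)) k) :=
    IsScalarTower.of_algebraMap_eq fun a ↦ ((aeval y).commutes a).symm
  have hirr : ∀ L : MvPolynomial (Fin (n + 1)) k, L.IsHomogeneous 1 → L ∈ irrelevantIdeal k n := by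
    intro L hL
    have := hL.sum_X_mul_pderiv
    rw [one_smul] at this
    rw [← this]
    exact Ideal.sum_mem _ fun i _ ↦ Ideal.mul_mem_right _ _ (Ideal.subset_span ⟨i, rfl⟩)
  let s : Fin (n - 1) := ⟨0, by omega⟩
  have hs : algebraMap (MvPolynomial (Fin (n - 1)) k) (MvPolynomial (Fin (n + 1)) k) (X s) ∈
      irrelevantIdeal k n := by
    have : algebraMap (MvPolynomial (Fin (n - 1)) k) (MvPolynomial (Fin (n + 1)) k) (X s) = y s :=
      aeval_X y s
    rw [this]
    exact hirr _ (hy s)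
  have huniq : ∀ L ∈ A.forms, ∀ M ∈ A.forms, L ≠ M → ∀ M' ∈ A.forms, L ≠ M' →
      3 ≤ (A.forms.filter (· ∈ Ideal.span {L, M})).card →
      3 ≤ (A.forms.filter (· ∈ Ideal.span {L, M'})).card →
        Ideal.span {L, M} = Ideal.span {L, M'} := by
    intro L hL M hM hLM M' hM' hLM' h3 h3'
    obtain ⟨q, hq, hrad⟩ := HyperplaneArrangement.exists_mem_heightTwoComponents h ht hL hM hLM
    obtain ⟨q', hq', hrad'⟩ :=
      HyperplaneArrangement.exists_mem_heightTwoComponents h ht hL hM' hLM'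
    rw [← hrad, ← hrad', hA L hL q hq q' hq'
      (HyperplaneArrangement.not_isRadical h ht hq.1 hL hM hLM hrad h3)
      (HyperplaneArrangement.not_isRadical h ht hq'.1 hL hM' hLM' hrad' h3')
      (hrad ▸ Ideal.left_mem_span_pair L M) (hrad' ▸ Ideal.left_mem_span_pair L M')]
  refine ⟨?_, ?_, fun b hb ↦ ?_⟩
  · rw [HyperplaneArrangement.topDimensionalPart_eq h ht]
    exact saturation_eq_and_isACM s hs
      (HyperplaneArrangement.isFiniteProjectiveQuotient_inter_localJacobian h huniq)
  · rcases A.forms.eq_empty_or_nonempty with hA0 | hA0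
    -- For the empty arrangement `√J = 0`, and the coordinate ring is the whole polynomial ring.
    · have hJ : A.jacobianIdeal.radical = ⊥ := by
        have : A.jacobianIdeal = ⊥ := by
          simp [HyperplaneArrangement.jacobianIdeal, HyperplaneArrangement.poly, hA0]
        rw [this, Ideal.isPrime_bot.radical]
      rw [hJ]
      have hbot : IsFiniteProjectiveQuotient (MvPolynomial (Fin (n + 1)) k)
          (⊥ : Ideal (MvPolynomial (Fin (n + 1)) k)) :=
        ⟨inferInstance, Module.Projective.of_equiv
          (Submodule.quotEquivOfEqBot (⊥ : Ideal (MvPolynomial (Fin (n + 1)) k)) rfl).symm⟩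
      exact saturation_eq_and_isACM (0 : Fin (n + 1)) (hirr _ (isHomogeneous_X k 0)) hbot
    · rw [HyperplaneArrangement.radical_jacobianIdeal_eq h hA0]
      refine saturation_eq_and_isACM s hs
        (HyperplaneArrangement.isFiniteProjectiveQuotient_inter_pow h huniq (fun _ ↦ 1)
          fun L hL M hM hLM ↦ ⟨fun _ ↦ rfl, fun h3 ↦ ?_⟩)
      omega
  · have hfat : fatIdeal t b = FlatSystem.inter (fun p ↦ p ^ b p) A.forms :=
      HyperplaneArrangement.iInf_heightTwoComponents h ht fun p ↦ p ^ b p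
    rw [hfat]
    refine saturation_eq_and_isACM s hs
      (HyperplaneArrangement.isFiniteProjectiveQuotient_inter_pow h huniq b
        fun L hL M hM hLM ↦ ?_)
    obtain ⟨q, hq, hrad⟩ := HyperplaneArrangement.exists_mem_heightTwoComponents h ht hL hM hLM
    rw [← hrad]
    exact hb q hq
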